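/- Fix continuous functions $f:[0,1]^2\to(0,\infty)$ and $g:\partial[0,1]^2\to(0,\infty)$ and constants $0\le q_{\min}<q_{\max}<\infty$. For $N\ge 3$ let $h=1/N$ and $d=(N-1)^2$. For $\mathbf q=(q_{i,j})_{1\le i,j\le N-1}\in\mathcal F:=[q_{\min},q_{\max}]^d$ let $G(\mathbf q)=(u_{i,j})_{1\le i,j\le N-1}\in\mathbb R^d$ be the unique solution of the finite difference scheme for $-\Delta u+qu=f$ on $[0,1]^2$, $u=g$ on $\partial [0,1]^2$, that is, $$-\frac{u_{i-1,j}+u_{i+1,j}-4u_{i,j}+u_{i,j-1}+u_{i,j+1}}{h^2}+q_{i,j}u_{i,j}=f(ih,jh)\qquad(1\le i,j\le N-1),$$ where $u_{i,j}=g(ih,jh)$ whenever $i\in\{0,N\}$ or $j\in\{0,N\}$. Let $N=N_n\ge 3$ depend on $n\in\mathbb N$, and write $d=d_n=(N_n-1)^2$. Let the truth $\mathbf q_0=\mathbf q_0^{(n)}\in\mathbb R^{d}$ lie strictly inside $\mathcal F$, uniformly in $n$: there is $\rho>0$, independent of $n$, such that all components of $\mathbf q_0^{(n)}$ lie in $[q_{\min}+\rho,q_{\max}-\rho]$.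 The data are $\mathbf Y_n=G(\mathbf q_0)+n^{-1/2}\eta$ with $\eta\sim N(0,\mathbf I_d)$ and $|\cdot|$ the Euclidean norm. The prior is $\Pi(d\mathbf q)=\prod_{i=1}^d\pi_i(\mathbf q_i)\,d\mathbf q_i$, where the $\pi_i$ (which may depend on $n$) are probability densities on $\mathbb R$ that vanish outside $[q_{\min},q_{\max}]$, are positive on $[q_{\min},q_{\max}]$, and satisfy, with constants independent of $i$ and $n$: (a) there is $C>0$ such that $|\log\pi_i(x)-\log\pi_i(y)|\le C$ for all $x,y\in[q_{\min},q_{\max}]$; (b) for every $\delta>0$ there is $C_\delta>0$ such that $|\log\pi_i(x)-\log\pi_i(y)|\le C_\delta|x-y|$ for all $x,y\in[q_{\min},q_{\max}]$ with $|x-y|\le\delta$. Let $\Pi_n$ be the posterior, i.e. the probability measure $$\Pi_n(d\mathbf q)\propto\exp\Big(-\frac n2|\mathbf Y_n-G(\mathbf q)|^2\Big)\,\Pi(d\mathbf q),$$ and put $\boldsymbol\Sigma=(\nabla G(\mathbf q_0)^T\nabla G(\mathbf q_0))^{-1}$, $\Delta_n=\mathbf q_0+n^{-1/2}\boldsymbol\Sigma\nabla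 G(\mathbf q_0)^T\eta$ and $\boldsymbol\Sigma_n=\frac1n\boldsymbol\Sigma$. If $\delta_n:=n^{-1/2}d^3\log d\to0$ as $n\to\infty$, then $$d_{TV}\big(\Pi_n,N(\Delta_n,\boldsymbol\Sigma_n)\big)=\mathcal O_p(\delta_n)\qquad(n\to\infty),$$ that is, for every $\varepsilon>0$ there is $M>0$ such that, for all sufficiently large $n$, $d_{TV}(\Pi_n,N(\Delta_n,\boldsymbol\Sigma_n))\le M\delta_n$ with probability at least $1-\varepsilon$. -/

import Mathlib

open MeasureTheory ProbabilityTheory Filter Topology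

noncomputable section

/-- Interior grid points of the uniform mesh on `[0,1]²` with `N = m + 1` subdivisions per side:
the pair `(a, b)` stands for the node with (one-based) indices `(a + 1, b + 1)`.
There are `d = m ^ 2 = (N - 1) ^ 2` of them. -/
abbrev Grid (m : ℕ) : Type := Fin m × Fin m

/-- Grid vectors, with the Euclidean norm. -/
abbrev GridVec (m : ℕ) : Type := EuclideanSpace ℝ (Grid m)

/-- The closed unit square. -/
def unitSquare : Set (ℝ × ℝ) := Set.Icc 0 1 ×ˢ Set.Icc 0 1

/-- The mesh size `h = 1 / N = 1 / (m + 1)`. -/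
def meshSize (m : ℕ) : ℝ := 1 / ((m : ℝ) + 1)

/-- The one-dimensional coordinate `x_{a+1} = (a + 1) h`. -/
def gridCoord {m : ℕ} (a : Fin m) : ℝ := ((a : ℝ) + 1) * meshSize m

/-- Neighbouring one-dimensional indices. -/
def IsNeighbor {m : ℕ} (a b : Fin m) : Prop := (a : ℕ) + 1 = b ∨ (b : ℕ) + 1 = a

open Classical in
/-- The matrix `A` of the five-point stencil (without the factor `h⁻²`):
`4` on the diagonal, `-1` between horizontally or vertically adjacent interior nodes. -/
def stencilMatrix (m : ℕ) : Matrix (Grid m) (Grid m) ℝ := Matrix.of fun p r =>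
  if p = r then 4
  else if (p.1 = r.1 ∧ IsNeighbor p.2 r.2) ∨ (p.2 = r.2 ∧ IsNeighbor p.1 r.1) then -1
  else 0

/-- The samples of the source `f` at the interior nodes. -/
def sourceVec (f : ℝ × ℝ → ℝ) (m : ℕ) : Grid m → ℝ :=
  fun p => f (gridCoord p.1, gridCoord p.2)

/-- The boundary data vector: for each interior node, the sum of `g` over those of its four
neighbours that lie on the boundary of the square. -/
def boundaryVec (g : ℝ × ℝ → ℝ) (m : ℕ) : Grid m → ℝ := fun p =>
  (if (p.1 : ℕ) = 0 then g (0, gridCoord p.2) else 0)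
  + (if (p.1 : ℕ) + 1 = m then g (1, gridCoord p.2) else 0)
  + (if (p.2 : ℕ) = 0 then g (gridCoord p.1, 0) else 0)
  + (if (p.2 : ℕ) + 1 = m then g (gridCoord p.1, 1) else 0)

/-- The forward map `G(q) = (h⁻² A + diag q)⁻¹ (f + h⁻² g)`: the solution of the finite difference
scheme for `-Δu + q u = f` in the unit square, `u = g` on its boundary. -/
def forwardMap (f g : ℝ × ℝ → ℝ) (m : ℕ) (q : GridVec m) : GridVec m :=
  WithLp.toLp 2
    (Matrix.mulVec
      ((meshSize m ^ 2)⁻¹ • stencilMatrix m + Matrix.diagonal (fun p => q p))⁻¹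
      (sourceVec f m + (meshSize m ^ 2)⁻¹ • boundaryVec g m))

/-- The Jacobian matrix `∇G(q)`. -/
def jacobian {m : ℕ} (G : GridVec m → GridVec m) (q : GridVec m) :
    Matrix (Grid m) (Grid m) ℝ :=
  Matrix.of fun i j => (fderiv ℝ G q (EuclideanSpace.single j 1)) i

/-- `Σ = (∇G(q₀)ᵀ ∇G(q₀))⁻¹`. -/
def limitCov {m : ℕ} (G : GridVec m → GridVec m) (q₀ : GridVec m) :
    Matrix (Grid m) (Grid m) ℝ :=
  ((jacobian G q₀).transpose * jacobian G q₀)⁻¹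

/-- The observation `Y = G(q₀) + n^{-1/2} η`. -/
def observation {m : ℕ} (G : GridVec m → GridVec m) (n : ℕ) (q₀ η : GridVec m) : GridVec m :=
  G q₀ + (Real.sqrt n)⁻¹ • η

/-- The random centre `Δ_n = q₀ + n^{-1/2} Σ ∇G(q₀)ᵀ η`. -/
def centre {m : ℕ} (G : GridVec m → GridVec m) (n : ℕ) (q₀ η : GridVec m) : GridVec m :=
  q₀ + (Real.sqrt n)⁻¹ •
    WithLp.toLp 2 (Matrix.mulVec (limitCov G q₀ * (jacobian G q₀).transpose) (fun i => η i))

/-- The normal law `N(Δ_n, Σ_n)` with `Σ_n = n⁻¹ Σ`. -/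
def normalApprox {m : ℕ} (G : GridVec m → GridVec m) (n : ℕ) (q₀ η : GridVec m) :
    Measure (GridVec m) :=
  multivariateGaussian (centre G n q₀ η) ((n : ℝ)⁻¹ • limitCov G q₀)

/-- The prior, whose density with respect to Lebesgue measure is `∏ᵢ πᵢ(qᵢ)`. -/
def productPrior {m : ℕ} (p : Grid m → ℝ → ℝ) : Measure (GridVec m) :=
  volume.withDensity fun q => ENNReal.ofReal (∏ i, p i (q i))

/-- The posterior `Π_n(dq) ∝ exp(-(n/2) |Y - G(q)|²) Π(dq)`, normalised to total mass one. -/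
def gridPosterior {m : ℕ} (G : GridVec m → GridVec m) (n : ℕ) (Y : GridVec m)
    (prior : Measure (GridVec m)) : Measure (GridVec m) :=
  prior.tilted fun q => -((n : ℝ) / 2) * ‖Y - G q‖ ^ 2

/-- A probability density on `ℝ` that vanishes off `[a, b]` and is positive on `[a, b]`
(so that its logarithm makes sense there). -/
structure IsComponentDensity (a b : ℝ) (p : ℝ → ℝ) : Prop where
  measurable : Measurable p
  pos : ∀ x ∈ Set.Icc a b, 0 < p x
  eq_zero : ∀ x ∉ Set.Icc a b, p x = 0
  lintegral_eq_one : ∫⁻ x, ENNReal.ofReal (p x) = 1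

/-- The assumptions on the component densities of the priors (one family of component densities
for each `n`); the constants do not depend on `n` or on the component. -/
structure PriorAssumptions (a b : ℝ) {m : ℕ → ℕ} (p : ∀ n, Grid (m n) → ℝ → ℝ) : Prop where
  density : ∀ n i, IsComponentDensity a b (p n i)
  log_bounded : ∃ C > 0, ∀ n i, ∀ x ∈ Set.Icc a b, ∀ y ∈ Set.Icc a b,
    |Real.log (p n i x) - Real.log (p n i y)| ≤ C
  log_lipschitz : ∀ δ > 0, ∃ C > 0, ∀ n i, ∀ x ∈ Set.Icc a b, ∀ y ∈ Set.Icc a b,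
    |x - y| ≤ δ → |Real.log (p n i x) - Real.log (p n i y)| ≤ C * |x - y|

/-- The total variation distance `sup_A |μ(A) - ν(A)|` (half the `L¹` distance of the densities,
for probability measures that have densities). -/
def tvDist {X : Type*} [MeasurableSpace X] (μ ν : Measure X) : ℝ :=
  ⨆ A : {A : Set X // MeasurableSet A}, |μ.real A - ν.real A|

/-- `X_n = O_p(r_n)` as `n → ∞`. -/
def IsBigOInProbability {Ω : Type*} [MeasurableSpace Ω] (P : Measure Ω)
    (X : ℕ → Ω → ℝ) (r : ℕ → ℝ) : Prop :=
  ∀ ε : ℝ, 0 < ε → ∃ M : ℝ, 0 < M ∧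
    ∀ᶠ n in atTop, P {ω | M * r n < |X n ω|} ≤ ENNReal.ofReal ε

/-- The rate `n^{-1/2} d³ log d` with `d = m ^ 2`. -/
def bvmRate (n m : ℕ) : ℝ :=
  (Real.sqrt n)⁻¹ * ((m : ℝ) ^ 2) ^ 3 * Real.log ((m : ℝ) ^ 2)

end

/-! The equation `A_q G(q) = b`, with `A_q = h⁻²A + diag q`, is bilinear in `(q, G(q))`, so
linearization errors can be computed exactly. Write `δ = q - q₀`, `J = ∇G(q₀)`, `u = G(q₀)`, and `∘`
for the componentwise product. Then `A_{q₀} J δ = -u ∘ δ` and `A_q (G(q) - u - J δ) = -δ ∘ J δ`. A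
quadratic supersolution makes `A_q ≥ 1` as a quadratic form for every `q ≥ 0`, uniformly in the
mesh; hence the error is at most `‖δ‖_∞ ‖J δ‖` (`norm_forwardMap_sub_sub_le`), and likewise `‖J δ‖ ≤
(1 + ‖δ‖_∞) ‖G(q) - u‖` (`norm_forwardDeriv_le`). Since `u` is bounded below by the maximum
principle and `‖A_{q₀}‖ = O(m²)`, also `‖δ‖ = O(m² ‖J δ‖)` (`le_norm_forwardDeriv`).

Put `z = √n J δ` and `s = √n (G(q) - u)`. The posterior has density proportional to `exp (l - ‖η -
s‖² / 2)` on the box, `l` being the log prior ratio, while the normal law has density proportional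
to `exp (-‖η - z‖² / 2)`. With `τ` of order `m² / √n` and `‖η‖ = O(m)`, the exponents differ by `O(τ
m³)` while `‖z‖ = O(m)`; beyond that, Gaussian decay wins over the prior and over powers of `‖z‖`.
So the densities differ pointwise by `O(τ m³)` times the sum of the normal density and a flatter
Gaussian density (`exists_abs_weight_sub_le`), both of mass one. Integrating over the whole space
bounds total variation by `O(m⁵ / √n)`, with no separate contraction argument
(`exists_tvDist_posterior_le`). This is below the required rate, and Markov's inequality controls
`‖η‖`. -/

/-! ### Maximum principle, coercivity and Schur's test for matrices -/

section MMatrix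

open Matrix

variable {ι : Type*} [Fintype ι]

/-- The discrete maximum principle for matrices with nonpositive off-diagonal entries and a
strict positive supersolution. -/
theorem nonneg_of_mulVec_nonneg {M : Matrix ι ι ℝ} (hoff : ∀ i j, i ≠ j → M i j ≤ 0)
    {ψ : ι → ℝ} (hψ : ∀ i, 0 < ψ i) (hMψ : ∀ i, 0 < (M *ᵥ ψ) i)
    {x : ι → ℝ} (hx : ∀ i, 0 ≤ (M *ᵥ x) i) (i : ι) : 0 ≤ x i := by
  classical
  -- Work at a minimizer of `x / ψ`: if the minimum `t` were negative, row `p` would give `(M x) p ≤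
  -- t (M ψ) p < 0`.
  obtain ⟨p, -, hp⟩ := Finset.exists_min_image Finset.univ (fun i => x i / ψ i) ⟨i, Finset.mem_univ i⟩
  have hp' : ∀ j, x p / ψ p ≤ x j / ψ j := fun j => hp j (Finset.mem_univ j)
  suffices h : 0 ≤ x p / ψ p by
    have := h.trans (hp' i)
    rw [le_div_iff₀ (hψ i)] at this
    simpa using this
  by_contra! hneg
  set t := x p / ψ p with ht
  have hxp : x p = t * ψ p := by rw [ht, div_mul_cancel₀ _ (hψ p).ne']
  have hle : (M *ᵥ x) p ≤ t * (M *ᵥ ψ) p := by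
    simp only [mulVec, dotProduct, Finset.mul_sum]
    refine Finset.sum_le_sum fun j _ => ?_
    by_cases hj : p = j
    · subst hj; rw [hxp]; linarith [mul_left_comm t (M p p) (ψ p)]
    · have h1 : t * ψ j ≤ x j := (le_div_iff₀ (hψ j)).1 (hp' j)
      nlinarith [hoff p j hj]
  nlinarith [hx p, hMψ p]

/-- A symmetric matrix with nonpositive off-diagonal entries is coercive if it has a positive
supersolution. -/
theorem mul_sum_sq_le_dotProduct_mulVec {M : Matrix ι ι ℝ} (hsymm : ∀ i j, M i j = M j i)
    (hoff : ∀ i j, i ≠ j → M i j ≤ 0) {ψ : ι → ℝ} (hψ : ∀ i, 0 < ψ i) {c : ℝ}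
    (hMψ : ∀ i, c * ψ i ≤ (M *ᵥ ψ) i) (x : ι → ℝ) :
    c * ∑ i, x i ^ 2 ≤ x ⬝ᵥ M *ᵥ x := by
  have h1 : c * ∑ i, x i ^ 2 ≤ ∑ i, ∑ j, M i j * (x i ^ 2 * (ψ j / ψ i)) := by
    rw [Finset.mul_sum]
    refine Finset.sum_le_sum fun i _ => ?_
    have : ∑ j, M i j * (x i ^ 2 * (ψ j / ψ i)) = x i ^ 2 / ψ i * (M *ᵥ ψ) i := by
      simp only [mulVec, dotProduct, Finset.mul_sum]
      refine Finset.sum_congr rfl fun j _ => by ring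
    rw [this]
    have h := mul_le_mul_of_nonneg_left (hMψ i) (div_nonneg (sq_nonneg (x i)) (hψ i).le)
    refine le_trans (le_of_eq ?_) h
    have := (hψ i).ne'
    field_simp
  have h2 : ∑ i, ∑ j, M i j * (x i ^ 2 * (ψ j / ψ i))
      = ∑ i, ∑ j, M i j * (x j ^ 2 * (ψ i / ψ j)) := by
    rw [Finset.sum_comm]
    refine Finset.sum_congr rfl fun i _ => Finset.sum_congr rfl fun j _ => by rw [hsymm]
  -- Weighted AM–GM, `2 x i x j ≤ x i² ψ j / ψ i + x j² ψ i / ψ j`, is reversed by the nonpositive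
  -- off-diagonal entries; on the diagonal it is an equality.
  have h3 : ∑ i, ∑ j, M i j * (x i ^ 2 * (ψ j / ψ i)) + ∑ i, ∑ j, M i j * (x j ^ 2 * (ψ i / ψ j))
      ≤ 2 * (x ⬝ᵥ M *ᵥ x) := by
    simp only [mulVec, dotProduct, Finset.mul_sum, ← Finset.sum_add_distrib]
    refine Finset.sum_le_sum fun i _ => Finset.sum_le_sum fun j _ => ?_
    have hi := hψ i
    have hj := hψ j
    by_cases hij : i = j
    · subst hij
      rw [div_self hi.ne']
      exact le_of_eq (by ring)
    · have hid : x i ^ 2 * (ψ j / ψ i) + x j ^ 2 * (ψ i / ψ j) - 2 * (x i * x j)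
          = (x i * ψ j - x j * ψ i) ^ 2 / (ψ i * ψ j) := by
        field_simp
        ring
      have : 0 ≤ x i ^ 2 * (ψ j / ψ i) + x j ^ 2 * (ψ i / ψ j) - 2 * (x i * x j) := by
        rw [hid]; positivity
      nlinarith [hoff i j hij]
  linarith

/-- Schur's test for a symmetric matrix. -/
theorem sum_sq_mulVec_le {M : Matrix ι ι ℝ} (hsymm : ∀ i j, M i j = M j i) {c : ℝ}
    (hrow : ∀ i, ∑ j, |M i j| ≤ c) (x : ι → ℝ) :
    ∑ i, (M *ᵥ x) i ^ 2 ≤ c ^ 2 * ∑ i, x i ^ 2 := by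
  have h1 : ∀ i, (M *ᵥ x) i ^ 2 ≤ c * ∑ j, |M i j| * x j ^ 2 := fun i => by
    -- Cauchy–Schwarz after splitting each weight `|M i j|` into two square roots.
    have h := Finset.sum_mul_sq_le_sq_mul_sq Finset.univ (fun j => √|M i j|)
      (fun j => √|M i j| * |x j|)
    have e1 : ∑ j, √|M i j| * (√|M i j| * |x j|) = ∑ j, |M i j * x j| := by
      refine Finset.sum_congr rfl fun j _ => ?_
      rw [← mul_assoc, Real.mul_self_sqrt (abs_nonneg _), abs_mul]
    have e2 : ∑ j, (√|M i j|) ^ 2 = ∑ j, |M i j| :=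
      Finset.sum_congr rfl fun j _ => Real.sq_sqrt (abs_nonneg _)
    have e3 : ∑ j, (√|M i j| * |x j|) ^ 2 = ∑ j, |M i j| * x j ^ 2 :=
      Finset.sum_congr rfl fun j _ => by rw [mul_pow, Real.sq_sqrt (abs_nonneg _), sq_abs]
    rw [e1, e2, e3] at h
    have habs : |(M *ᵥ x) i| ≤ ∑ j, |M i j * x j| := Finset.abs_sum_le_sum_abs _ _
    calc (M *ᵥ x) i ^ 2 = |(M *ᵥ x) i| ^ 2 := (sq_abs _).symm
      _ ≤ (∑ j, |M i j * x j|) ^ 2 := by gcongr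
      _ ≤ _ := h
      _ ≤ _ := by
        refine mul_le_mul_of_nonneg_right (hrow i) (Finset.sum_nonneg fun j _ => ?_)
        positivity
  rcases isEmpty_or_nonempty ι with hι | ⟨⟨i₀⟩⟩
  · simp
  have hc : 0 ≤ c := (Finset.sum_nonneg fun j _ => abs_nonneg _).trans (hrow i₀)
  calc ∑ i, (M *ᵥ x) i ^ 2 ≤ ∑ i, c * ∑ j, |M i j| * x j ^ 2 := Finset.sum_le_sum fun i _ => h1 i
    _ = c * ∑ j, (∑ i, |M j i|) * x j ^ 2 := by
      rw [← Finset.mul_sum, Finset.sum_comm]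
      congr 1
      refine Finset.sum_congr rfl fun j _ => ?_
      rw [Finset.sum_mul]
      exact Finset.sum_congr rfl fun i _ => by rw [hsymm]
    _ ≤ c * ∑ j, c * x j ^ 2 := by
      refine mul_le_mul_of_nonneg_left (Finset.sum_le_sum fun j _ => ?_) hc
      exact mul_le_mul_of_nonneg_right (hrow j) (sq_nonneg _)
    _ = _ := by rw [← Finset.mul_sum]; ring

end MMatrix

/-! ### The five-point stencil -/

section Stencil

open Matrix

-- The zero-based node `b` has index `b + 1` on the extended grid `0, …, m + 1`, so the neighbours
-- of `a` sit at `a` and `a + 2`; a neighbour on the boundary is not an unknown and is subtracted.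
open Classical in
theorem sum_neighbors {m : ℕ} (a : Fin m) (Φ : ℕ → ℝ) :
    ∑ b : Fin m, (if IsNeighbor a b then Φ (b + 1) else 0)
      = Φ a + Φ (a + 2) - (if (a : ℕ) = 0 then Φ 0 else 0)
        - (if (a : ℕ) + 1 = m then Φ (m + 1) else 0) := by
  have hsplit : ∀ b : Fin m, (if IsNeighbor a b then Φ (b + 1) else 0)
      = (if (b : ℕ) = a + 1 then Φ (a + 2) else 0) + (if (b : ℕ) + 1 = a then Φ a else 0) := by
    intro b
    unfold IsNeighbor
    by_cases h1 : (b : ℕ) = a + 1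
    · have h2 : ¬ ((b : ℕ) + 1 = a) := by omega
      rw [if_pos (Or.inl h1.symm), if_pos h1, if_neg h2, h1, add_zero]
    · by_cases h2 : (b : ℕ) + 1 = a
      · simp [h2]; omega
      · rw [if_neg (by omega), if_neg h1, if_neg h2, add_zero]
  simp_rw [hsplit, Finset.sum_add_distrib]
  have e1 : ∑ b : Fin m, (if (b : ℕ) = a + 1 then Φ (a + 2) else 0)
      = Φ (a + 2) - (if (a : ℕ) + 1 = m then Φ (m + 1) else 0) := by
    by_cases h : (a : ℕ) + 1 = m
    · rw [if_pos h, Finset.sum_eq_zero fun b _ => if_neg (by omega),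
        show (a : ℕ) + 2 = m + 1 by omega, sub_self]
    · rw [if_neg h, sub_zero, Finset.sum_eq_single (⟨a + 1, by omega⟩ : Fin m)]
      · simp
      · intro b _ hb
        exact if_neg fun hh => hb (Fin.ext hh)
      · simp
  have e2 : ∑ b : Fin m, (if (b : ℕ) + 1 = a then Φ a else 0)
      = Φ a - (if (a : ℕ) = 0 then Φ 0 else 0) := by
    by_cases h : (a : ℕ) = 0
    · rw [if_pos h, Finset.sum_eq_zero fun b _ => if_neg (by omega), h, sub_self]
    · rw [if_neg h, sub_zero, Finset.sum_eq_single (⟨a - 1, by omega⟩ : Fin m)]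
      · rw [if_pos]; simp; omega
      · intro b _ hb
        exact if_neg fun hh => hb (Fin.ext (by simp; omega))
      · simp
  rw [e1, e2]; ring

open Classical in
theorem stencilMatrix_apply {m : ℕ} (p r : Grid m) :
    stencilMatrix m p r = 4 * (if p = r then 1 else 0)
      - (if p.1 = r.1 then (if IsNeighbor p.2 r.2 then 1 else 0) else 0)
      - (if p.2 = r.2 then (if IsNeighbor p.1 r.1 then 1 else 0) else 0) := by
  have hirr : ∀ a : Fin m, ¬ IsNeighbor a a := fun a h => by unfold IsNeighbor at h; omega
  obtain ⟨p1, p2⟩ := p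
  obtain ⟨r1, r2⟩ := r
  simp only [stencilMatrix, Matrix.of_apply, Prod.mk.injEq]
  by_cases h1 : p1 = r1 <;> by_cases h2 : p2 = r2
  · subst h1 h2; simp [hirr]
  · subst h1; simp only [h2]; split_ifs <;> simp_all
  · subst h2; simp only [h1]; split_ifs <;> simp_all
  · simp [h1, h2]

/-- The action of the five-point stencil on the restriction of a function on the extended grid. -/
theorem stencilMatrix_mulVec {m : ℕ} (Ψ : ℕ → ℕ → ℝ) (p : Grid m) :
    (stencilMatrix m *ᵥ fun r => Ψ (r.1 + 1) (r.2 + 1)) p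
      = 4 * Ψ (p.1 + 1) (p.2 + 1) - Ψ p.1 (p.2 + 1) - Ψ (p.1 + 2) (p.2 + 1)
        - Ψ (p.1 + 1) p.2 - Ψ (p.1 + 1) (p.2 + 2)
        + ((if (p.1 : ℕ) = 0 then Ψ 0 (p.2 + 1) else 0)
          + (if (p.1 : ℕ) + 1 = m then Ψ (m + 1) (p.2 + 1) else 0)
          + (if (p.2 : ℕ) = 0 then Ψ (p.1 + 1) 0 else 0)
          + (if (p.2 : ℕ) + 1 = m then Ψ (p.1 + 1) (m + 1) else 0)) := by
  classical
  have h1 := sum_neighbors p.1 (fun k => Ψ k (p.2 + 1))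
  have h2 := sum_neighbors p.2 (fun k => Ψ (p.1 + 1) k)
  simp only [mulVec, dotProduct, stencilMatrix_apply, sub_mul, Finset.sum_sub_distrib]
  have e0 : ∑ r : Grid m, 4 * (if p = r then (1 : ℝ) else 0) * Ψ (r.1 + 1) (r.2 + 1)
      = 4 * Ψ (p.1 + 1) (p.2 + 1) := by simp
  have e1 : ∑ r : Grid m, (if p.1 = r.1 then (if IsNeighbor p.2 r.2 then (1 : ℝ) else 0) else 0)
      * Ψ (r.1 + 1) (r.2 + 1)
      = ∑ b : Fin m, (if IsNeighbor p.2 b then Ψ (p.1 + 1) (b + 1) else 0) := by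
    rw [Fintype.sum_prod_type]
    rw [Finset.sum_eq_single p.1]
    · simp
    · intro a _ ha; simp [Ne.symm ha]
    · simp
  have e2 : ∑ r : Grid m, (if p.2 = r.2 then (if IsNeighbor p.1 r.1 then (1 : ℝ) else 0) else 0)
      * Ψ (r.1 + 1) (r.2 + 1)
      = ∑ a : Fin m, (if IsNeighbor p.1 a then Ψ (a + 1) (p.2 + 1) else 0) := by
    rw [Fintype.sum_prod_type_right]
    rw [Finset.sum_eq_single p.2]
    · simp
    · intro a _ ha; simp [Ne.symm ha]
    · simp
  rw [e0, e1, e2, h1, h2]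
  ring

theorem stencilMatrix_symm {m : ℕ} (p r : Grid m) : stencilMatrix m p r = stencilMatrix m r p := by
  classical
  have hn : ∀ a b : Fin m, IsNeighbor a b ↔ IsNeighbor b a := fun a b => or_comm
  simp only [stencilMatrix_apply, eq_comm, hn p.1 r.1, hn p.2 r.2]

theorem stencilMatrix_off_diag {m : ℕ} (p r : Grid m) (h : p ≠ r) : stencilMatrix m p r ≤ 0 := by
  classical
  simp only [stencilMatrix_apply, if_neg h]
  split_ifs <;> norm_num

/-- The number of boundary neighbours of an interior node. -/
def boundaryCount {m : ℕ} (p : Grid m) : ℝ :=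
  (if (p.1 : ℕ) = 0 then 1 else 0) + (if (p.1 : ℕ) + 1 = m then 1 else 0)
  + (if (p.2 : ℕ) = 0 then 1 else 0) + (if (p.2 : ℕ) + 1 = m then 1 else 0)

theorem boundaryCount_nonneg {m : ℕ} (p : Grid m) : 0 ≤ boundaryCount p := by
  unfold boundaryCount; positivity

theorem stencilMatrix_mulVec_const {m : ℕ} (c : ℝ) (p : Grid m) :
    (stencilMatrix m *ᵥ fun _ => c) p = c * boundaryCount p := by
  rw [stencilMatrix_mulVec (fun _ _ => c) p]
  simp only [boundaryCount, mul_add, mul_ite, mul_one, mul_zero]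
  ring

/-- Only the diagonal entry `4` is positive, so the absolute row sum is `8` minus the row sum, and
the latter is the boundary count. -/
theorem sum_abs_stencilMatrix_le {m : ℕ} (p : Grid m) : ∑ r, |stencilMatrix m p r| ≤ 8 := by
  classical
  have h : ∀ r, |stencilMatrix m p r| = (if p = r then 8 else 0) - stencilMatrix m p r * 1 := by
    intro r
    by_cases hr : p = r
    · subst hr; simp [stencilMatrix]; norm_num
    · rw [abs_of_nonpos (stencilMatrix_off_diag p r hr), if_neg hr]; ring
  have h1 := stencilMatrix_mulVec_const 1 p
  simp only [mulVec, dotProduct] at h1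
  simp_rw [h, Finset.sum_sub_distrib, h1]
  have := boundaryCount_nonneg p
  simp
  linarith

/-- A quadratic supersolution of the discrete Laplacian. -/
def parabolaVec (m : ℕ) : Grid m → ℝ := fun p => ((p.1 : ℝ) + 1) * ((m : ℝ) - p.1)

theorem parabolaVec_pos {m : ℕ} (p : Grid m) : 0 < parabolaVec m p := by
  have : ((p.1 : ℕ) : ℝ) < m := by exact_mod_cast p.1.2
  have := sub_pos.2 this
  unfold parabolaVec; positivity

theorem parabolaVec_le {m : ℕ} (p : Grid m) : parabolaVec m p ≤ ((m : ℝ) + 1) ^ 2 := by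
  have : ((p.1 : ℕ) : ℝ) < m := by exact_mod_cast p.1.2
  have h0 : (0 : ℝ) ≤ (p.1 : ℕ) := by positivity
  unfold parabolaVec; nlinarith

/-- The parabola `i (N - i)` has second difference exactly `-2` and vanishes at `i = 0, N`; the
truncated neighbours in the other direction only add nonnegative terms. -/
theorem two_le_stencilMatrix_mulVec_parabolaVec {m : ℕ} (p : Grid m) :
    2 ≤ (stencilMatrix m *ᵥ parabolaVec m) p := by
  have h := stencilMatrix_mulVec (m := m) (fun i _ => (i : ℝ) * ((m : ℝ) + 1 - i)) p
  have e : (fun r : Grid m => (((r.1 : ℕ) + 1 : ℕ) : ℝ) * ((m : ℝ) + 1 - ((r.1 : ℕ) + 1 : ℕ)))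
      = parabolaVec m := by
    ext r; simp only [parabolaVec]; push_cast; ring
  rw [e] at h
  rw [h]
  have hp : ((p.1 : ℕ) : ℝ) + 1 ≤ m := by exact_mod_cast p.1.2
  have h0 : (0 : ℝ) ≤ (p.1 : ℕ) := by positivity
  have hb1 : 0 ≤ (if (p.2 : ℕ) = 0 then (((p.1 : ℕ) + 1 : ℕ) : ℝ) * ((m : ℝ) + 1 - ((p.1 : ℕ) + 1 : ℕ)) else 0) := by
    split_ifs
    · push_cast; nlinarith
    · rfl
  have hb2 : 0 ≤ (if (p.2 : ℕ) + 1 = m then (((p.1 : ℕ) + 1 : ℕ) : ℝ) * ((m : ℝ) + 1 - ((p.1 : ℕ) + 1 : ℕ)) else 0) := by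
    split_ifs
    · push_cast; nlinarith
    · rfl
  have hb3 : (if (p.1 : ℕ) + 1 = m then ((m + 1 : ℕ) : ℝ) * ((m : ℝ) + 1 - (m + 1 : ℕ)) else 0) = 0 := by
    split_ifs <;> simp
  have hb4 : (if (p.1 : ℕ) = 0 then ((0 : ℕ) : ℝ) * ((m : ℝ) + 1 - (0 : ℕ)) else 0) = 0 := by
    split_ifs <;> simp
  rw [hb3, hb4]
  push_cast at hb1 hb2 ⊢
  nlinarith

end Stencil

/-! ### The finite difference operator: stability and lower bounds for its solutions -/

section Scheme

open Matrix

/-- The matrix `h⁻² A + diag q` of the finite difference scheme. -/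
noncomputable def schemeMatrix (m : ℕ) (q : GridVec m) : Matrix (Grid m) (Grid m) ℝ :=
  (meshSize m ^ 2)⁻¹ • stencilMatrix m + Matrix.diagonal (fun p => q p)

/-- The operator `h⁻² A + diag q` on grid vectors. -/
noncomputable def schemeOp (m : ℕ) (q : GridVec m) : GridVec m →L[ℝ] GridVec m :=
  Matrix.toEuclideanCLM (𝕜 := ℝ) (schemeMatrix m q)

/-- The right-hand side of the finite difference scheme. -/
noncomputable def schemeRhs (f g : ℝ × ℝ → ℝ) (m : ℕ) : GridVec m :=
  WithLp.toLp 2 (sourceVec f m + (meshSize m ^ 2)⁻¹ • boundaryVec g m)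

/-- The componentwise product of grid vectors. -/
def pointwiseMul {m : ℕ} (x y : GridVec m) : GridVec m := WithLp.toLp 2 fun p => x p * y p

@[simp]
theorem pointwiseMul_apply {m : ℕ} (x y : GridVec m) (p : Grid m) : pointwiseMul x y p = x p * y p := rfl

theorem inv_meshSize_sq (m : ℕ) : (meshSize m ^ 2)⁻¹ = ((m : ℝ) + 1) ^ 2 := by
  simp [meshSize]

theorem schemeOp_eq_mulVec {m : ℕ} (q x : GridVec m) (p : Grid m) :
    schemeOp m q x p = (schemeMatrix m q *ᵥ x) p := rfl

theorem schemeMatrix_mulVec {m : ℕ} (q : GridVec m) (x : Grid m → ℝ) (p : Grid m) :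
    (schemeMatrix m q *ᵥ x) p = ((m : ℝ) + 1) ^ 2 * (stencilMatrix m *ᵥ x) p + q p * x p := by
  simp [schemeMatrix, Matrix.add_mulVec, inv_meshSize_sq, Matrix.smul_mulVec,
    Matrix.mulVec_diagonal]

theorem schemeOp_sub {m : ℕ} (q q' x : GridVec m) :
    schemeOp m q x = schemeOp m q' x + pointwiseMul (q - q') x := by
  ext p
  simp only [PiLp.add_apply, schemeOp_eq_mulVec, schemeMatrix_mulVec, pointwiseMul_apply,
    PiLp.sub_apply]
  ring

theorem schemeMatrix_symm {m : ℕ} (q : GridVec m) (p r : Grid m) :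
    schemeMatrix m q p r = schemeMatrix m q r p := by
  by_cases h : p = r
  · rw [h]
  · simp [schemeMatrix, Matrix.diagonal_apply_ne _ h, Matrix.diagonal_apply_ne _ (Ne.symm h),
      stencilMatrix_symm p r]

theorem schemeMatrix_off_diag {m : ℕ} (q : GridVec m) (p r : Grid m) (h : p ≠ r) :
    schemeMatrix m q p r ≤ 0 := by
  simp only [schemeMatrix, Matrix.add_apply, Matrix.smul_apply, Matrix.diagonal_apply_ne _ h,
    add_zero, smul_eq_mul]
  exact mul_nonpos_of_nonneg_of_nonpos (by positivity) (stencilMatrix_off_diag p r h)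

/-- The factor `h⁻² = (m + 1)²` dominates the maximum of the parabola, so the supersolution constant
can be `1` on every mesh. -/
theorem parabolaVec_le_schemeMatrix_mulVec {m : ℕ} {q : GridVec m} (hq : ∀ p, 0 ≤ q p)
    (p : Grid m) : parabolaVec m p ≤ (schemeMatrix m q *ᵥ parabolaVec m) p := by
  rw [schemeMatrix_mulVec]
  have h1 := two_le_stencilMatrix_mulVec_parabolaVec p
  have h2 := parabolaVec_le p
  have h3 := mul_nonneg (hq p) (parabolaVec_pos p).le
  nlinarith [sq_nonneg ((m : ℝ) + 1)]

/-- Coercivity with constant `1` and Cauchy–Schwarz. The inverse operator is a contraction uniformly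
in the mesh and in `q ≥ 0`, so the linearization estimates lose no power of the dimension. -/
theorem norm_le_norm_schemeOp {m : ℕ} {q : GridVec m} (hq : ∀ p, 0 ≤ q p) (x : GridVec m) :
    ‖x‖ ≤ ‖schemeOp m q x‖ := by
  have h := mul_sum_sq_le_dotProduct_mulVec (schemeMatrix_symm q) (schemeMatrix_off_diag q)
    parabolaVec_pos (c := 1) (fun p => by
      rw [one_mul]; exact parabolaVec_le_schemeMatrix_mulVec hq p) x
  have h1 : (x : Grid m → ℝ) ⬝ᵥ schemeMatrix m q *ᵥ x = inner ℝ x (schemeOp m q x) := by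
    simp only [dotProduct, PiLp.inner_apply, schemeOp_eq_mulVec]
    exact Finset.sum_congr rfl fun i _ => by simp [mul_comm]
  rw [one_mul, ← EuclideanSpace.real_norm_sq_eq, h1] at h
  have h2 := h.trans (real_inner_le_norm _ _)
  rcases (norm_nonneg x).eq_or_lt with h0 | h0
  · rw [← h0]; exact norm_nonneg _
  · rw [sq] at h2; exact le_of_mul_le_mul_left h2 h0

theorem schemeOp_injective {m : ℕ} {q : GridVec m} (hq : ∀ p, 0 ≤ q p) :
    Function.Injective (schemeOp m q) := by
  refine (injective_iff_map_eq_zero _).2 fun x hx => ?_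
  have := norm_le_norm_schemeOp hq x
  rw [hx, norm_zero] at this
  exact norm_le_zero_iff.1 this

theorem isUnit_det_schemeMatrix {m : ℕ} {q : GridVec m} (hq : ∀ p, 0 ≤ q p) :
    IsUnit (schemeMatrix m q).det := by
  rw [← Matrix.isUnit_iff_isUnit_det, ← Matrix.mulVec_injective_iff_isUnit]
  intro x y hxy
  have := @schemeOp_injective m q hq (WithLp.toLp 2 x) (WithLp.toLp 2 y)
    (by ext p; exact congrFun hxy p)
  simpa using this

theorem norm_pointwiseMul_le {m : ℕ} {x : GridVec m} {B : ℝ} (hB : 0 ≤ B) (hx : ∀ p, |x p| ≤ B)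
    (y : GridVec m) : ‖pointwiseMul x y‖ ≤ B * ‖y‖ := by
  refine le_of_sq_le_sq ?_ (by positivity)
  rw [mul_pow, EuclideanSpace.real_norm_sq_eq, EuclideanSpace.real_norm_sq_eq, Finset.mul_sum]
  refine Finset.sum_le_sum fun p _ => ?_
  rw [pointwiseMul_apply, mul_pow]
  exact mul_le_mul_of_nonneg_right (sq_le_sq' (abs_le.1 (hx p)).1 (abs_le.1 (hx p)).2)
    (sq_nonneg _)

theorem le_norm_pointwiseMul {m : ℕ} {x : GridVec m} {B : ℝ} (hB : 0 ≤ B) (hx : ∀ p, B ≤ x p)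
    (y : GridVec m) : B * ‖y‖ ≤ ‖pointwiseMul x y‖ := by
  refine le_of_sq_le_sq ?_ (by positivity)
  rw [mul_pow, EuclideanSpace.real_norm_sq_eq, EuclideanSpace.real_norm_sq_eq, Finset.mul_sum]
  refine Finset.sum_le_sum fun p _ => ?_
  rw [pointwiseMul_apply, mul_pow]
  exact mul_le_mul_of_nonneg_right (pow_le_pow_left₀ hB (hx p) 2) (sq_nonneg _)

/-- Schur's test gives `8` for the stencil, and `(m + 1)² ≤ 4 m²` turns this into `32 m²`. -/
theorem norm_schemeOp_le {m : ℕ} (hm : 1 ≤ m) {q : GridVec m} {B : ℝ} (hB : 0 ≤ B)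
    (hq : ∀ p, |q p| ≤ B) (x : GridVec m) :
    ‖schemeOp m q x‖ ≤ (32 + B) * (m : ℝ) ^ 2 * ‖x‖ := by
  have hm' : (1 : ℝ) ≤ m := by exact_mod_cast hm
  set y : GridVec m := WithLp.toLp 2 (stencilMatrix m *ᵥ x) with hy
  have hdec : schemeOp m q x = ((m : ℝ) + 1) ^ 2 • y + pointwiseMul q x := by
    ext p
    simp [schemeOp_eq_mulVec, schemeMatrix_mulVec, hy]
  have hy8 : ‖y‖ ≤ 8 * ‖x‖ := by
    refine le_of_sq_le_sq ?_ (by positivity)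
    rw [mul_pow, EuclideanSpace.real_norm_sq_eq, EuclideanSpace.real_norm_sq_eq]
    exact sum_sq_mulVec_le stencilMatrix_symm sum_abs_stencilMatrix_le _
  have h1 : ‖((m : ℝ) + 1) ^ 2 • y‖ ≤ 32 * (m : ℝ) ^ 2 * ‖x‖ := by
    rw [norm_smul, Real.norm_of_nonneg (by positivity)]
    calc ((m : ℝ) + 1) ^ 2 * ‖y‖ ≤ (2 * (m : ℝ)) ^ 2 * (8 * ‖x‖) := by gcongr; linarith
      _ = _ := by ring
  have h2 : ‖pointwiseMul q x‖ ≤ B * (m : ℝ) ^ 2 * ‖x‖ := by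
    refine (norm_pointwiseMul_le hB hq x).trans ?_
    have : B * 1 ≤ B * (m : ℝ) ^ 2 := mul_le_mul_of_nonneg_left (one_le_pow₀ hm') hB
    nlinarith [norm_nonneg x]
  rw [hdec]
  refine (norm_add_le _ _).trans ?_
  linarith

variable {f g : ℝ × ℝ → ℝ}

theorem schemeOp_forwardMap {m : ℕ} {q : GridVec m} (hq : ∀ p, 0 ≤ q p) :
    schemeOp m q (forwardMap f g m q) = schemeRhs f g m := by
  ext p
  rw [schemeOp_eq_mulVec]
  change (schemeMatrix m q *ᵥ ((schemeMatrix m q)⁻¹ *ᵥ _)) p = _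
  rw [Matrix.mulVec_mulVec, Matrix.mul_nonsing_inv _ (isUnit_det_schemeMatrix hq),
    Matrix.one_mulVec]
  rfl

/-- The hypothesis says that the constant `s` is a subsolution; the maximum principle applies to the
difference. -/
theorem le_forwardMap {m : ℕ} {q : GridVec m} (hq : ∀ p, 0 ≤ q p) {s : ℝ}
    (hs : ∀ p, ((m : ℝ) + 1) ^ 2 * (s * boundaryCount p) + q p * s ≤ schemeRhs f g m p)
    (p : Grid m) : s ≤ forwardMap f g m q p := by
  have h := nonneg_of_mulVec_nonneg (schemeMatrix_off_diag q) parabolaVec_pos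
    (fun p => (parabolaVec_pos p).trans_le (parabolaVec_le_schemeMatrix_mulVec hq p))
    (x := (fun p => forwardMap f g m q p) - fun _ => s) (fun p => ?_) p
  · simpa using h
  · have h1 : (schemeMatrix m q *ᵥ fun p => forwardMap f g m q p) p = schemeRhs f g m p := by
      rw [← schemeOp_forwardMap hq]; rfl
    rw [Matrix.mulVec_sub, Pi.sub_apply, h1, schemeMatrix_mulVec, stencilMatrix_mulVec_const]
    linarith [hs p]

theorem gridCoord_mem {m : ℕ} (a : Fin m) : gridCoord a ∈ Set.Icc (0 : ℝ) 1 := by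
  have h : ((a : ℕ) : ℝ) + 1 ≤ m := by exact_mod_cast a.2
  unfold gridCoord meshSize
  constructor
  · positivity
  · rw [mul_one_div, div_le_one (by positivity)]; linarith

theorem isCompact_unitSquare : IsCompact unitSquare := isCompact_Icc.prod isCompact_Icc

theorem mem_frontier_unitSquare {x y : ℝ} (hx : x ∈ Set.Icc (0 : ℝ) 1) (hy : y ∈ Set.Icc (0 : ℝ) 1)
    (h : x = 0 ∨ x = 1 ∨ y = 0 ∨ y = 1) : (x, y) ∈ frontier unitSquare := by
  rw [frontier, unitSquare, interior_prod_eq, interior_Icc, IsClosed.closure_eq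
    (isClosed_Icc.prod isClosed_Icc)]
  refine ⟨⟨hx, hy⟩, fun hh => ?_⟩
  obtain ⟨⟨h1, h2⟩, h3, h4⟩ := hh
  simp only at h1 h2 h3 h4
  rcases h with h | h | h | h <;> linarith

/-- Positive lower bounds for the data of the boundary value problem. -/
theorem exists_lower_bounds
    (hf_cont : ContinuousOn f unitSquare) (hf_pos : ∀ x ∈ unitSquare, 0 < f x)
    (hg_cont : ContinuousOn g (frontier unitSquare))
    (hg_pos : ∀ x ∈ frontier unitSquare, 0 < g x) :
    ∃ c > 0, (∀ x ∈ unitSquare, c ≤ f x) ∧ ∀ x ∈ frontier unitSquare, c ≤ g x := by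
  have h0 : (0 : ℝ) ∈ Set.Icc (0 : ℝ) 1 := by simp
  have hfr : IsCompact (frontier unitSquare) :=
    isCompact_unitSquare.of_isClosed_subset isClosed_frontier
      isCompact_unitSquare.isClosed.frontier_subset
  obtain ⟨x, hx, hxm⟩ := isCompact_unitSquare.exists_isMinOn ⟨(0, 0), ⟨h0, h0⟩⟩ hf_cont
  obtain ⟨y, hy, hym⟩ := hfr.exists_isMinOn
    ⟨(0, 0), mem_frontier_unitSquare h0 h0 (Or.inl rfl)⟩ hg_cont
  exact ⟨min (f x) (g y), lt_min (hf_pos x hx) (hg_pos y hy),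
    fun z hz => (min_le_left _ _).trans (hxm hz), fun z hz => (min_le_right _ _).trans (hym hz)⟩

theorem mul_boundaryCount_le_boundaryVec {c : ℝ} (hg : ∀ x ∈ frontier unitSquare, c ≤ g x)
    {m : ℕ} (p : Grid m) : c * boundaryCount p ≤ boundaryVec g m p := by
  have h0 : (0 : ℝ) ∈ Set.Icc (0 : ℝ) 1 := by simp
  have h1 : (1 : ℝ) ∈ Set.Icc (0 : ℝ) 1 := by simp
  have e1 := hg _ (mem_frontier_unitSquare h0 (gridCoord_mem p.2) (by simp))
  have e2 := hg _ (mem_frontier_unitSquare h1 (gridCoord_mem p.2) (by simp))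
  have e3 := hg _ (mem_frontier_unitSquare (gridCoord_mem p.1) h0 (by simp))
  have e4 := hg _ (mem_frontier_unitSquare (gridCoord_mem p.1) h1 (by simp))
  simp only [boundaryCount, boundaryVec, mul_add, mul_ite, mul_one, mul_zero]
  gcongr <;> split_ifs <;> first | assumption | exact le_rfl

/-- The discrete solutions are bounded below, uniformly in the mesh. -/
theorem forwardMap_lower_bound {c qmax : ℝ} (hc : 0 < c) (hqmax : 0 ≤ qmax)
    (hf : ∀ x ∈ unitSquare, c ≤ f x) (hg : ∀ x ∈ frontier unitSquare, c ≤ g x) {m : ℕ}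
    {q : GridVec m} (hq : ∀ p, q p ∈ Set.Icc 0 qmax) (p : Grid m) :
    c / (1 + qmax) ≤ forwardMap f g m q p := by
  -- The constant `c / (1 + qmax)` is at most `c`, for comparison with `g`, and at most `c` after
  -- multiplication by `q`, for comparison with `f`.
  refine le_forwardMap (fun p => (hq p).1) (fun p => ?_) p
  have h1 : c / (1 + qmax) ≤ c := div_le_self hc.le (by linarith)
  have h2 : q p * (c / (1 + qmax)) ≤ c := by
    rw [mul_div_assoc', div_le_iff₀ (by linarith)]
    nlinarith [(hq p).2]
  have h3 : c ≤ sourceVec f m p := hf _ ⟨gridCoord_mem p.1, gridCoord_mem p.2⟩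
  have h4 := mul_boundaryCount_le_boundaryVec hg p
  have h5 := mul_le_mul_of_nonneg_right h1 (boundaryCount_nonneg p)
  have h6 := mul_le_mul_of_nonneg_left (h5.trans h4) (sq_nonneg ((m : ℝ) + 1))
  change _ ≤ sourceVec f m p + (meshSize m ^ 2)⁻¹ • boundaryVec g m p
  rw [inv_meshSize_sq, smul_eq_mul]
  linarith

/-- The inverse is the adjugate times the inverted determinant, hence measurable also across
singular matrices, where it takes its default value. -/
theorem measurable_forwardMap {m : ℕ} : Measurable (forwardMap f g m) := by
  have hM : Continuous fun q : GridVec m => schemeMatrix m q := by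
    unfold schemeMatrix
    refine continuous_const.add (Continuous.matrix_diagonal ?_)
    fun_prop
  refine (WithLp.measurable_toLp 2 _).comp (measurable_pi_iff.2 fun p => ?_)
  change Measurable fun q : GridVec m =>
    ((schemeMatrix m q)⁻¹ *ᵥ (sourceVec f m + (meshSize m ^ 2)⁻¹ • boundaryVec g m)) p
  simp only [Matrix.mulVec, dotProduct]
  refine Finset.measurable_sum _ fun r _ => Measurable.mul_const ?_ _
  simp only [Matrix.inv_def, Ring.inverse_eq_inv', Matrix.smul_apply, smul_eq_mul]
  exact hM.matrix_det.measurable.inv.mul (hM.matrix_adjugate.matrix_elem p r).measurable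

end Scheme

/-! ### Derivative of the forward map and two-sided linearization bounds -/

section Linearization

open Matrix

/-- The Jacobian matrix `-(h⁻² A + diag q)⁻¹ diag (G q)` of the forward map. -/
noncomputable def forwardJacobian (f g : ℝ × ℝ → ℝ) (m : ℕ) (q : GridVec m) :
    Matrix (Grid m) (Grid m) ℝ :=
  -((schemeMatrix m q)⁻¹ * Matrix.diagonal fun p => forwardMap f g m q p)

/-- The derivative of the forward map. -/
noncomputable def forwardDeriv (f g : ℝ × ℝ → ℝ) (m : ℕ) (q : GridVec m) :
    GridVec m →L[ℝ] GridVec m :=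
  Matrix.toEuclideanCLM (𝕜 := ℝ) (forwardJacobian f g m q)

variable {f g : ℝ × ℝ → ℝ} {m : ℕ}

/-- This is `A_q G(q) = b` differentiated in the direction `v`. -/
theorem schemeOp_forwardDeriv {q : GridVec m} (hq : ∀ p, 0 ≤ q p) (v : GridVec m) :
    schemeOp m q (forwardDeriv f g m q v) = -pointwiseMul (forwardMap f g m q) v := by
  ext p
  rw [schemeOp_eq_mulVec]
  change (schemeMatrix m q *ᵥ (forwardJacobian f g m q *ᵥ v)) p = _
  rw [Matrix.mulVec_mulVec, forwardJacobian, mul_neg, Matrix.mul_nonsing_inv_cancel_left _ _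
    (isUnit_det_schemeMatrix hq), Matrix.neg_mulVec]
  simp [Matrix.mulVec_diagonal]

theorem pointwiseMul_comm (x y : GridVec m) : pointwiseMul x y = pointwiseMul y x := by
  ext p; simp [mul_comm]

theorem pointwiseMul_sub (x y z : GridVec m) : pointwiseMul x (y - z) = pointwiseMul x y - pointwiseMul x z := by
  ext p; simp [mul_sub]

/-- The linearization error of the forward map is controlled by its linearization. -/
theorem norm_forwardMap_sub_sub_le {q₀ q : GridVec m} (hq₀ : ∀ p, 0 ≤ q₀ p) (hq : ∀ p, 0 ≤ q p)
    {B : ℝ} (hB : 0 ≤ B) (hqB : ∀ p, |(q - q₀) p| ≤ B) :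
    ‖forwardMap f g m q - forwardMap f g m q₀ - forwardDeriv f g m q₀ (q - q₀)‖
      ≤ B * ‖forwardDeriv f g m q₀ (q - q₀)‖ := by
  -- Apply the operator at `q`, not at `q₀`: the terms linear in `q - q₀` cancel exactly, and `-(q -
  -- q₀) ∘ J (q - q₀)` remains.
  refine (norm_le_norm_schemeOp hq _).trans ?_
  refine le_trans (le_of_eq ?_) (norm_pointwiseMul_le hB hqB _)
  rw [← norm_neg (pointwiseMul _ _)]
  congr 1
  rw [map_sub, map_sub, schemeOp_forwardMap hq, schemeOp_sub q q₀ (forwardMap f g m q₀),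
    schemeOp_forwardMap hq₀, schemeOp_sub q q₀ (forwardDeriv _ _ _ _ _), schemeOp_forwardDeriv hq₀,
    pointwiseMul_comm (q - q₀) (forwardMap f g m q₀)]
  abel

/-- Here the operator at `q₀` is used, which sends `w - s` to `(q - q₀) ∘ s`. The bound needs no
smallness of `B`, so the likelihood decays in `J (q - q₀)` over the whole box. -/
theorem norm_forwardDeriv_le {q₀ q : GridVec m} (hq₀ : ∀ p, 0 ≤ q₀ p) (hq : ∀ p, 0 ≤ q p)
    {B : ℝ} (hB : 0 ≤ B) (hqB : ∀ p, |(q - q₀) p| ≤ B) :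
    ‖forwardDeriv f g m q₀ (q - q₀)‖
      ≤ (1 + B) * ‖forwardMap f g m q - forwardMap f g m q₀‖ := by
  set s := forwardMap f g m q - forwardMap f g m q₀ with hs
  set w := forwardDeriv f g m q₀ (q - q₀) with hw
  have h : ‖w - s‖ ≤ B * ‖s‖ := by
    refine (norm_le_norm_schemeOp hq₀ _).trans ?_
    refine le_trans (le_of_eq ?_) (norm_pointwiseMul_le hB hqB _)
    congr 1
    have h1 := schemeOp_sub q q₀ (forwardMap f g m q)
    rw [schemeOp_forwardMap hq] at h1
    have h2 := schemeOp_forwardMap (f := f) (g := g) hq₀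
    rw [map_sub, hw, schemeOp_forwardDeriv hq₀, hs, map_sub, h2,
      pointwiseMul_sub (q - q₀) (forwardMap f g m q), pointwiseMul_comm (forwardMap f g m q₀), h1]
    abel
  have := norm_add_le (w - s) s
  rw [sub_add_cancel] at this
  linarith

/-- A lower bound for the derivative of the forward map. -/
theorem le_norm_forwardDeriv (hm : 1 ≤ m) {q₀ : GridVec m} {c qmax : ℝ} (hc : 0 ≤ c)
    (hq₀ : ∀ p, q₀ p ∈ Set.Icc 0 qmax) (hqmax : 0 ≤ qmax)
    (hu : ∀ p, c ≤ forwardMap f g m q₀ p) (v : GridVec m) :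
    c * ‖v‖ ≤ (32 + qmax) * (m : ℝ) ^ 2 * ‖forwardDeriv f g m q₀ v‖ := by
  -- Since `-u ∘ v = A_{q₀} J v`, a lower bound on `u` and an upper bound on `‖A_{q₀}‖` suffice.
  refine (le_norm_pointwiseMul hc hu v).trans ?_
  rw [← norm_neg, ← schemeOp_forwardDeriv (fun p => (hq₀ p).1)]
  exact norm_schemeOp_le hm hqmax (fun p => by rw [abs_of_nonneg (hq₀ p).1]; exact (hq₀ p).2) _

/-- The linearization error is quadratic. Strict positivity of `q₀` keeps a whole neighbourhood
where the operator is coercive. -/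
theorem hasFDerivAt_forwardMap {q₀ : GridVec m} (hq₀ : ∀ p, 0 < q₀ p) :
    HasFDerivAt (forwardMap f g m) (forwardDeriv f g m q₀) q₀ := by
  rw [hasFDerivAt_iff_isLittleO]
  set J := forwardDeriv f g m q₀
  have hpos : ∀ᶠ q : GridVec m in 𝓝 q₀, ∀ p, 0 ≤ q p := by
    refine eventually_all.2 fun p => ?_
    have : Continuous fun q : GridVec m => q p := by fun_prop
    filter_upwards [this.continuousAt.eventually (lt_mem_nhds (hq₀ p))] with q hq using hq.le
  have hO : (fun q => forwardMap f g m q - forwardMap f g m q₀ - J (q - q₀))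
      =O[𝓝 q₀] fun q => ‖q - q₀‖ * ‖q - q₀‖ := by
    refine Asymptotics.IsBigO.of_bound ‖J‖ ?_
    filter_upwards [hpos] with q hq
    refine (norm_forwardMap_sub_sub_le (fun p => (hq₀ p).le) hq (norm_nonneg (q - q₀))
      (fun p => ?_)).trans ?_
    · rw [← Real.norm_eq_abs]; exact PiLp.norm_apply_le _ _
    · rw [Real.norm_of_nonneg (by positivity)]
      nlinarith [J.le_opNorm (q - q₀), norm_nonneg (q - q₀)]
  refine hO.trans_isLittleO ?_
  have h1 : (fun q : GridVec m => ‖q - q₀‖) =o[𝓝 q₀] fun _ => (1 : ℝ) := by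
    rw [Asymptotics.isLittleO_one_iff]
    have : Continuous fun q : GridVec m => ‖q - q₀‖ := by fun_prop
    simpa using this.tendsto q₀
  have h2 := h1.mul_isBigO (Asymptotics.isBigO_refl (fun q : GridVec m => ‖q - q₀‖) (𝓝 q₀))
  simp only [one_mul] at h2
  exact h2.trans_isBigO (Asymptotics.isBigO_norm_left.2 (Asymptotics.isBigO_refl _ _))

theorem jacobian_forwardMap {q₀ : GridVec m} (hq₀ : ∀ p, 0 < q₀ p) :
    jacobian (forwardMap f g m) q₀ = forwardJacobian f g m q₀ := by
  ext i j
  rw [jacobian, Matrix.of_apply, (hasFDerivAt_forwardMap hq₀).fderiv]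
  change (forwardJacobian f g m q₀ *ᵥ (EuclideanSpace.single j (1 : ℝ)).ofLp) i = _
  simp

theorem isUnit_det_forwardJacobian {q₀ : GridVec m} (hq₀ : ∀ p, 0 ≤ q₀ p)
    (hu : ∀ p, forwardMap f g m q₀ p ≠ 0) : IsUnit (forwardJacobian f g m q₀).det := by
  rw [forwardJacobian, ← neg_one_smul ℝ, Matrix.det_smul, Matrix.det_mul, Matrix.det_diagonal]
  refine (IsUnit.pow _ (by simp)).mul (IsUnit.mul ?_ ?_)
  · exact Matrix.isUnit_nonsing_inv_det _ (isUnit_det_schemeMatrix hq₀)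
  · exact (Finset.prod_ne_zero_iff.2 fun p _ => hu p).isUnit

end Linearization

/-! ### Scalar comparison of exponential weights -/

section ScalarBounds

theorem abs_exp_sub_exp_le_mul (a b : ℝ) :
    |Real.exp a - Real.exp b| ≤ |a - b| * (Real.exp a + Real.exp b) := by
  wlog h : b ≤ a generalizing a b
  · rw [abs_sub_comm, abs_sub_comm a, add_comm]; exact this b a (le_of_not_ge h)
  rw [abs_of_nonneg (sub_nonneg.2 (Real.exp_le_exp.2 h)), abs_of_nonneg (sub_nonneg.2 h)]
  have h1 : 1 - (a - b) ≤ Real.exp (b - a) := by linarith [Real.add_one_le_exp (b - a)]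
  have h2 : Real.exp b = Real.exp a * Real.exp (b - a) := by rw [← Real.exp_add]; ring_nf
  have h3 := mul_le_mul_of_nonneg_left h1 (Real.exp_pos a).le
  rw [← h2] at h3
  nlinarith [mul_nonneg (sub_nonneg.2 h) (Real.exp_pos b).le]

theorem cube_le_mul_exp {a Z : ℝ} (ha : 0 < a) (hZ : 1 ≤ Z) :
    Z ^ 3 ≤ 32 / a ^ 2 * Real.exp (a / 4 * Z ^ 2) := by
  have h := Real.quadratic_le_exp_of_nonneg (x := a / 4 * Z ^ 2) (by positivity)
  have h1 : (a / 4 * Z ^ 2) ^ 2 / 2 ≤ Real.exp (a / 4 * Z ^ 2) := by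
    have : 0 ≤ a / 4 * Z ^ 2 := by positivity
    linarith
  have h2 := mul_le_mul_of_nonneg_left h1 (show 0 ≤ 32 / a ^ 2 by positivity)
  refine le_trans ?_ h2
  have : 32 / a ^ 2 * ((a / 4 * Z ^ 2) ^ 2 / 2) = Z ^ 4 := by field_simp; ring
  rw [this]
  exact pow_le_pow_right₀ hZ (by norm_num)

/-- Beyond a large multiple of `x`, a Gaussian tail absorbs a cubic factor and `exp (c x ^ 2)`. -/
theorem cube_mul_exp_le {a c θ R x Z : ℝ} (ha : 0 < a) (hR : 1 ≤ R) (hRc : 2 * (c + θ) / a ≤ R)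
    (hx : 1 ≤ x) (hZ : R * x ≤ Z) :
    Z ^ 3 * Real.exp (c * x ^ 2 - a * Z ^ 2)
      ≤ 32 / a ^ 2 * (Real.exp (-θ * x ^ 2) * Real.exp (-(a / 4) * Z ^ 2)) := by
  have hZ1 : 1 ≤ Z := by nlinarith
  have h1 := mul_le_mul_of_nonneg_right (cube_le_mul_exp ha hZ1)
    (Real.exp_pos (c * x ^ 2 - a * Z ^ 2)).le
  refine h1.trans ?_
  -- The budget `a Z²` is split: one quarter has paid for the cube, one half absorbs `(c + θ) x²`,
  -- and one quarter survives.
  rw [mul_assoc, ← Real.exp_add, ← Real.exp_add]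
  refine mul_le_mul_of_nonneg_left (Real.exp_le_exp.2 ?_) (by positivity)
  have h2 : (R * x) ^ 2 ≤ Z ^ 2 := pow_le_pow_left₀ (by positivity) hZ 2
  have h3 : 2 * (c + θ) ≤ a * R ^ 2 := by
    rw [div_le_iff₀ ha] at hRc
    nlinarith [mul_nonneg ha.le (mul_nonneg (sub_nonneg.2 hR) (zero_le_one.trans hR))]
  have h4 : 2 * (c + θ) * x ^ 2 ≤ a * Z ^ 2 := by
    calc 2 * (c + θ) * x ^ 2 ≤ a * R ^ 2 * x ^ 2 := by gcongr
      _ = a * (R * x) ^ 2 := by ring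
      _ ≤ _ := by gcongr
  linarith

set_option maxHeartbeats 400000 in
/-- Comparison of a perturbed Gaussian weight `exp (l - e)` with the Gaussian weight `exp (-e₀)`.
Here `x` is the square root of the dimension, `H` and `Z` are the norms of the noise and of the
argument, `V ≤ τ Z` is the size of the parameter increment, and `S` is the size of the nonlinear
increment. -/
theorem exists_abs_exp_sub_exp_le {K D c : ℝ} (hK : 0 ≤ K) (hD : 0 ≤ D) (hc : 0 ≤ c) (θ : ℝ) :
    ∃ C > 0, ∀ x τ H V Z S l e e₀ : ℝ, 1 ≤ x → 0 ≤ τ → τ * x ^ 3 ≤ 1 → 0 ≤ H → H ≤ K * x →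
      0 ≤ V → V ≤ τ * Z → 0 ≤ Z → Z ≤ (1 + D) * S → |l| ≤ c * x * V → |l| ≤ c * x ^ 2 →
      |e - e₀| ≤ V * Z * (2 * H + (2 + D) * Z) / 2 → (H ≤ S / 2 → S ^ 2 / 8 ≤ e) →
      (H ≤ Z / 2 → Z ^ 2 / 8 ≤ e₀) →
      |Real.exp (l - e) - Real.exp (-e₀)| ≤ C * (τ * x ^ 3) * (Real.exp (-e₀)
        + Real.exp (-θ * x ^ 2) * Real.exp (-(1 / (32 * (1 + D) ^ 2)) * Z ^ 2)) := by
  -- With this choice `Z ≤ (1 + D) S` turns the decay `S² / 8` into `a Z²`.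
  set a := 1 / (8 * (1 + D) ^ 2) with ha
  have ha0 : 0 < a := by positivity
  have ha8 : a ≤ 1 / 8 := by
    rw [ha]
    exact one_div_le_one_div_of_le (by norm_num) (by nlinarith)
  have ha4 : 1 / (32 * (1 + D) ^ 2) = a / 4 := by rw [ha]; field_simp; norm_num
  -- For `Z ≥ R x`, the first summand gives `Z ≥ x`, the second puts the noise below `Z / 2` and `S
  -- / 2`, and the third lets the Gaussian decay absorb `exp ((c + θ) x²)`.
  set R := 1 + 2 * K * (1 + D) + 2 * |c + θ| / a with hR
  have hR1 : 1 ≤ R := by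
    have : 0 ≤ 2 * K * (1 + D) + 2 * |c + θ| / a := by positivity
    linarith
  have hRK : 2 * K * (1 + D) ≤ R := by
    have : 0 ≤ 2 * |c + θ| / a := by positivity
    linarith
  have hRc : 2 * (c + θ) / a ≤ R := by
    have h1 : 2 * (c + θ) / a ≤ 2 * |c + θ| / a := by gcongr; exact le_abs_self _
    have : 0 ≤ 2 * K * (1 + D) := by positivity
    linarith
  set C1 := c * R + K * R ^ 2 + (1 + D / 2) * R ^ 3 with hC1
  set C2 := c + K + 1 + D / 2 with hC2
  have hR0 : 0 < R := by linarith
  have hC1p : 0 < C1 := by positivity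
  have hC2p : 0 < C2 := by positivity
  refine ⟨C1 * (1 + Real.exp C1) + 2 * C2 * (32 / a ^ 2), by positivity, ?_⟩
  intro x τ H V Z S l e e₀ hx hτ hτx hH hHK hV hVZ hZ hZS hl1 hl2 he hSe hZe
  rw [ha4]
  have hx0 : 0 < x := by linarith
  have hx3 : 0 ≤ τ * x ^ 3 := by positivity
  have hψ : |l - e - -e₀| ≤ τ * (c * x * Z + Z ^ 2 * H + (1 + D / 2) * Z ^ 3) := by
    have h1 : |l - e - -e₀| ≤ |l| + |e - e₀| := by
      rw [show l - e - -e₀ = l - (e - e₀) by ring]; exact abs_sub _ _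
    have h2 : c * x * V ≤ c * x * (τ * Z) := by gcongr
    have h3 : V * Z * (2 * H + (2 + D) * Z) / 2 ≤ τ * Z * Z * (2 * H + (2 + D) * Z) / 2 := by
      gcongr
    refine (h1.trans (add_le_add (hl1.trans h2) (he.trans h3))).trans (le_of_eq ?_)
    ring
  have hsub := abs_exp_sub_exp_le_mul (l - e) (-e₀)
  set E := Real.exp (-e₀) with hE
  set X := Real.exp (-θ * x ^ 2) * Real.exp (-(a / 4) * Z ^ 2) with hX
  have hE0 : 0 < E := Real.exp_pos _
  have hX0 : 0 < X := by positivity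
  -- For `Z ≤ R x` the exponents differ by at most `C1 τ x³ ≤ C1`, so the two weights are
  -- comparable. Beyond, each weight is at most `exp (c x² - a Z²)`, which also absorbs the factor
  -- `Z³`.
  rcases le_total Z (R * x) with hZR | hZR
  · have h1 : |l - e - -e₀| ≤ C1 * (τ * x ^ 3) := by
      refine hψ.trans ?_
      have e1 : c * x * Z ≤ c * R * x ^ 3 := by
        calc c * x * Z ≤ c * x * (R * x) := by gcongr
          _ = c * R * x ^ 2 := by ring
          _ ≤ c * R * x ^ 3 := by gcongr; all_goals first | assumption | norm_num
      have e2 : Z ^ 2 * H ≤ K * R ^ 2 * x ^ 3 := by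
        calc Z ^ 2 * H ≤ (R * x) ^ 2 * (K * x) := by gcongr
          _ = _ := by ring
      have e3 : (1 + D / 2) * Z ^ 3 ≤ (1 + D / 2) * R ^ 3 * x ^ 3 := by
        calc (1 + D / 2) * Z ^ 3 ≤ (1 + D / 2) * (R * x) ^ 3 := by gcongr
          _ = _ := by ring
      calc _ ≤ τ * (c * R * x ^ 3 + K * R ^ 2 * x ^ 3 + (1 + D / 2) * R ^ 3 * x ^ 3) := by gcongr
        _ = _ := by rw [hC1]; ring
    have h2 : Real.exp (l - e) ≤ Real.exp C1 * E := by
      rw [hE, ← Real.exp_add]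
      refine Real.exp_le_exp.2 ?_
      have h3 : C1 * (τ * x ^ 3) ≤ C1 * 1 := by gcongr
      linarith [le_abs_self (l - e - -e₀)]
    calc _ ≤ _ := hsub
      _ ≤ C1 * (τ * x ^ 3) * (Real.exp C1 * E + E) := by gcongr
      _ = C1 * (1 + Real.exp C1) * (τ * x ^ 3) * E := by ring
      _ ≤ (C1 * (1 + Real.exp C1) + 2 * C2 * (32 / a ^ 2)) * (τ * x ^ 3) * E := by
        gcongr; exact le_add_of_nonneg_right (by positivity)
      _ ≤ _ := by gcongr; exact le_add_of_nonneg_right hX0.le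
  · have hxZ : x ≤ Z := (le_mul_of_one_le_left hx0.le hR1).trans hZR
    have hZ1 : 1 ≤ Z := hx.trans hxZ
    have hHZ' : 2 * H * (1 + D) ≤ Z := by
      calc 2 * H * (1 + D) ≤ 2 * (K * x) * (1 + D) := by gcongr
        _ = 2 * K * (1 + D) * x := by ring
        _ ≤ R * x := by gcongr
        _ ≤ Z := hZR
    have hHZ : H ≤ Z / 2 := by linarith [mul_nonneg hH hD]
    have hHS : H ≤ S / 2 := by
      refine le_of_mul_le_mul_left ?_ (show 0 < 2 * (1 + D) by positivity)
      linarith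
    have h1 : |l - e - -e₀| ≤ C2 * (τ * Z ^ 3) := by
      refine hψ.trans ?_
      have e0 : Z ^ 2 ≤ Z ^ 3 := pow_le_pow_right₀ hZ1 (by norm_num)
      have e1 : c * x * Z ≤ c * Z ^ 3 := by
        calc c * x * Z ≤ c * Z * Z := by gcongr
          _ = c * Z ^ 2 := by ring
          _ ≤ _ := by gcongr
      have e2 : Z ^ 2 * H ≤ K * Z ^ 3 := by
        calc Z ^ 2 * H ≤ Z ^ 2 * (K * Z) := by gcongr; exact hHK.trans (by gcongr)
          _ = _ := by ring
      calc _ ≤ τ * (c * Z ^ 3 + K * Z ^ 3 + (1 + D / 2) * Z ^ 3) := by gcongr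
        _ = _ := by rw [hC2]; ring
    have hS : a * Z ^ 2 ≤ S ^ 2 / 8 := by
      have : Z ^ 2 ≤ ((1 + D) * S) ^ 2 := pow_le_pow_left₀ hZ hZS 2
      rw [ha, div_mul_eq_mul_div, div_le_div_iff₀ (by positivity) (by norm_num)]
      rw [mul_pow] at this
      linarith
    have h2 : Real.exp (l - e) ≤ Real.exp (c * x ^ 2 - a * Z ^ 2) :=
      Real.exp_le_exp.2 (by linarith [le_abs_self l, hSe hHS])
    have h3 : E ≤ Real.exp (c * x ^ 2 - a * Z ^ 2) := by
      refine Real.exp_le_exp.2 ?_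
      have : 0 ≤ c * x ^ 2 := by positivity
      have : a * Z ^ 2 ≤ 1 / 8 * Z ^ 2 := by gcongr
      linarith [hZe hHZ]
    have h4 := cube_mul_exp_le ha0 hR1 hRc hx hZR
    calc _ ≤ _ := hsub
      _ ≤ C2 * (τ * Z ^ 3) * (Real.exp (c * x ^ 2 - a * Z ^ 2)
          + Real.exp (c * x ^ 2 - a * Z ^ 2)) := by gcongr
      _ = 2 * C2 * τ * (Z ^ 3 * Real.exp (c * x ^ 2 - a * Z ^ 2)) := by ring
      _ ≤ 2 * C2 * τ * (32 / a ^ 2 * X) := by gcongr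
      _ = 2 * C2 * (32 / a ^ 2) * (τ * 1) * X := by ring
      _ ≤ 2 * C2 * (32 / a ^ 2) * (τ * x ^ 3) * X := by gcongr; exact one_le_pow₀ hx
      _ ≤ (C1 * (1 + Real.exp C1) + 2 * C2 * (32 / a ^ 2)) * (τ * x ^ 3) * X := by
        gcongr; exact le_add_of_nonneg_left (by positivity)
      _ ≤ _ := by gcongr; exact le_add_of_nonneg_left hE0.le

/-- Far from the origin a Gaussian weight is small compared with the rate. -/
theorem exists_exp_neg_le {K ρ : ℝ} (hK : 0 ≤ K) (hρ : 0 < ρ) {D : ℝ} (hD : 0 ≤ D) (θ : ℝ) :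
    ∃ C > 0, ∀ x τ H Z e₀ : ℝ, 1 ≤ x → 0 ≤ τ → 0 ≤ H → H ≤ K * x → 0 ≤ Z → ρ ≤ τ * Z →
      (H ≤ Z / 2 → Z ^ 2 / 8 ≤ e₀) →
      Real.exp (-e₀) ≤ C * (τ * x ^ 3) * (Real.exp (-e₀)
        + Real.exp (-θ * x ^ 2) * Real.exp (-(1 / (32 * (1 + D) ^ 2)) * Z ^ 2)) := by
  set a := 1 / (8 * (1 + D) ^ 2) with ha
  have ha0 : 0 < a := by positivity
  have ha8 : a ≤ 1 / 8 := by
    rw [ha]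
    exact one_div_le_one_div_of_le (by norm_num) (by nlinarith)
  have ha4 : 1 / (32 * (1 + D) ^ 2) = a / 4 := by rw [ha]; field_simp; norm_num
  set R := 1 + 2 * K + 2 * |0 + θ| / a with hR
  have hR1 : 1 ≤ R := by
    have : 0 ≤ 2 * K + 2 * |0 + θ| / a := by positivity
    linarith
  have hRK : 2 * K ≤ R := by
    have : 0 ≤ 2 * |0 + θ| / a := by positivity
    linarith
  have hRc : 2 * (0 + θ) / a ≤ R := by
    have h1 : 2 * (0 + θ) / a ≤ 2 * |0 + θ| / a := by gcongr; exact le_abs_self _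
    linarith
  have hR0 : 0 < R := by linarith
  refine ⟨R / ρ + 32 / a ^ 2 / ρ, by positivity, ?_⟩
  intro x τ H Z e₀ hx hτ hH hHK hZ hρZ hZe
  rw [ha4]
  have hx0 : 0 < x := by linarith
  have hx3 : 0 ≤ τ * x ^ 3 := by positivity
  set E := Real.exp (-e₀) with hE
  set X := Real.exp (-θ * x ^ 2) * Real.exp (-(a / 4) * Z ^ 2) with hX
  have hE0 : 0 < E := Real.exp_pos _
  have hX0 : 0 < X := by positivity
  -- The distance hypothesis supplies the factor `τ` of the rate; the powers of `Z` are then treated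
  -- as in the previous comparison, with `c = 0` since no prior ratio occurs.
  have h1 : 1 ≤ τ * Z / ρ := (one_le_div hρ).2 hρZ
  have hEle : E ≤ τ * Z / ρ * E := by nlinarith
  rcases le_total Z (R * x) with hZR | hZR
  · calc E ≤ τ * Z / ρ * E := hEle
      _ ≤ τ * (R * x) / ρ * E := by gcongr
      _ = R / ρ * (τ * x ^ 1) * E := by ring
      _ ≤ R / ρ * (τ * x ^ 3) * E := by gcongr; all_goals first | assumption | norm_num
      _ ≤ (R / ρ + 32 / a ^ 2 / ρ) * (τ * x ^ 3) * (E + X) := by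
        gcongr
        · exact le_add_of_nonneg_right (by positivity)
        · exact le_add_of_nonneg_right hX0.le
  · have hxZ : x ≤ Z := (le_mul_of_one_le_left hx0.le hR1).trans hZR
    have hZ1 : 1 ≤ Z := hx.trans hxZ
    have hHZ : H ≤ Z / 2 := by nlinarith
    have h3 : E ≤ Real.exp (0 * x ^ 2 - a * Z ^ 2) := by
      refine Real.exp_le_exp.2 ?_
      have : a * Z ^ 2 ≤ 1 / 8 * Z ^ 2 := by gcongr
      linarith [hZe hHZ]
    have h4 := cube_mul_exp_le ha0 hR1 hRc hx hZR
    calc E ≤ τ * Z ^ 1 / ρ * E := by rwa [pow_one]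
      _ ≤ τ * Z ^ 3 / ρ * Real.exp (0 * x ^ 2 - a * Z ^ 2) := by
        gcongr
        norm_num
      _ = τ / ρ * (Z ^ 3 * Real.exp (0 * x ^ 2 - a * Z ^ 2)) := by ring
      _ ≤ τ / ρ * (32 / a ^ 2 * X) := by gcongr
      _ = 32 / a ^ 2 / ρ * (τ * 1) * X := by ring
      _ ≤ 32 / a ^ 2 / ρ * (τ * x ^ 3) * X := by gcongr; exact one_le_pow₀ hx
      _ ≤ _ := by
        gcongr
        · exact le_add_of_nonneg_left (by positivity)
        · exact le_add_of_nonneg_left hE0.le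

end ScalarBounds

/-! ### Gaussian densities and affine changes of variables -/

section GaussianWeight

variable {E : Type*} [NormedAddCommGroup E] [InnerProductSpace ℝ E]

/-- The centred isotropic Gaussian probability density proportional to `exp (-b ‖x‖ ^ 2)`. -/
noncomputable def gaussWeight (b : ℝ) (x : E) : ℝ :=
  ((Real.pi / b) ^ (Module.finrank ℝ E / 2 : ℝ))⁻¹ * Real.exp (-b * ‖x‖ ^ 2)

theorem gaussWeight_pos {b : ℝ} (hb : 0 < b) (x : E) : 0 < gaussWeight b x := by
  have := Real.pi_pos
  unfold gaussWeight; positivity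

theorem continuous_gaussWeight (b : ℝ) : Continuous (gaussWeight (E := E) b) := by
  unfold gaussWeight; fun_prop

/-- The Jacobian determinant of a linear change of variables. -/
noncomputable def absDet (L : E ≃L[ℝ] E) : ℝ := |LinearMap.det (L : E →ₗ[ℝ] E)|

theorem absDet_pos (L : E ≃L[ℝ] E) : 0 < absDet L :=
  abs_pos.2 (LinearEquiv.isUnit_det' L.toLinearEquiv).ne_zero

/-- The affine homeomorphism `q ↦ L (q - q₀) - η`. -/
noncomputable def affineHomeo (L : E ≃L[ℝ] E) (q₀ η : E) : E ≃ₜ E :=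
  ((Homeomorph.subRight q₀).trans L.toHomeomorph).trans (Homeomorph.subRight η)

theorem affineHomeo_apply (L : E ≃L[ℝ] E) (q₀ η q : E) :
    affineHomeo L q₀ η q = L (q - q₀) - η := rfl

theorem affineHomeo_symm_apply (L : E ≃L[ℝ] E) (q₀ η x : E) :
    (affineHomeo L q₀ η).symm x = q₀ + L.symm (x + η) := by
  rw [Homeomorph.symm_apply_eq, affineHomeo_apply]; simp

end GaussianWeight

section GaussianDensity

variable {E : Type*} [NormedAddCommGroup E] [InnerProductSpace ℝ E] [FiniteDimensional ℝ E]
  [MeasurableSpace E] [BorelSpace E]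

theorem integrable_gaussWeight {b : ℝ} (hb : 0 < b) : Integrable (gaussWeight (E := E) b) := by
  refine Integrable.const_mul (Integrable.of_integral_ne_zero ?_) _
  rw [GaussianFourier.integral_rexp_neg_mul_sq_norm hb]
  have := Real.pi_pos
  positivity

theorem integral_gaussWeight {b : ℝ} (hb : 0 < b) : ∫ x : E, gaussWeight b x = 1 := by
  have := Real.pi_pos
  simp only [gaussWeight]
  rw [integral_const_mul, GaussianFourier.integral_rexp_neg_mul_sq_norm hb,
    inv_mul_cancel₀ (by positivity)]

/-- Both sides have the same characteristic function, by the Gaussian integral with an imaginary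
linear term. -/
theorem stdGaussian_eq_withDensity :
    stdGaussian E = volume.withDensity fun x => ENNReal.ofReal (gaussWeight (1 / 2) x) := by
  have hint := integrable_gaussWeight (E := E) (b := 1 / 2) (by norm_num)
  have := isFiniteMeasure_withDensity_ofReal hint.2
  have hpi := Real.pi_pos
  refine Measure.ext_of_charFun (funext fun t => ?_)
  rw [charFun_stdGaussian, charFun_apply, integral_withDensity_eq_integral_toReal_smul
    (continuous_gaussWeight _).measurable.ennreal_ofReal (ae_of_all _ fun _ => ENNReal.ofReal_lt_top)]
  have h := GaussianFourier.integral_cexp_neg_mul_sq_norm_add (V := E) (b := ((1 / 2 : ℝ) : ℂ))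
    (by simp) Complex.I t
  set N : ℝ := (Real.pi / (1 / 2)) ^ (Module.finrank ℝ E / 2 : ℝ) with hN
  have hN0 : (N : ℂ) ≠ 0 := by
    have : N ≠ 0 := by positivity
    exact_mod_cast this
  have hNc : ((Real.pi : ℂ) / ((1 / 2 : ℝ) : ℂ)) ^ ((Module.finrank ℝ E : ℂ) / 2) = N := by
    rw [hN, ← Complex.ofReal_div, Complex.ofReal_cpow (by positivity)]
    simp
  rw [hNc] at h
  have hfun : ∀ x : E, (ENNReal.ofReal (gaussWeight (1 / 2) x)).toReal •
      Complex.exp ((inner ℝ x t : ℝ) * Complex.I)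
      = (N : ℂ)⁻¹ * Complex.exp (-((1 / 2 : ℝ) : ℂ) * (‖x‖ : ℂ) ^ 2 + Complex.I * (inner ℝ t x : ℝ)) := by
    intro x
    rw [ENNReal.toReal_ofReal (gaussWeight_pos (by norm_num) x).le, gaussWeight, ← hN,
      Complex.exp_add, real_inner_comm, mul_comm Complex.I, Complex.real_smul]
    push_cast
    ring
  simp_rw [hfun]
  rw [integral_const_mul, h, ← mul_assoc, inv_mul_cancel₀ hN0, one_mul]
  congr 1
  rw [Complex.I_sq]
  push_cast
  ring

theorem map_continuousLinearEquiv_volume (L : E ≃L[ℝ] E) :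
    Measure.map L volume
      = ENNReal.ofReal |(LinearMap.det (L : E →ₗ[ℝ] E))⁻¹| • (volume : Measure E) :=
  Measure.map_linearMap_addHaar_eq_smul_addHaar (f := (L : E →ₗ[ℝ] E)) volume
    (LinearEquiv.isUnit_det' L.toLinearEquiv).ne_zero

theorem map_affineHomeo_volume (L : E ≃L[ℝ] E) (q₀ η : E) :
    Measure.map (affineHomeo L q₀ η) volume
      = ENNReal.ofReal (absDet L)⁻¹ • (volume : Measure E) := by
  have h : (affineHomeo L q₀ η : E → E) = (fun x => x - η) ∘ L ∘ fun q => q - q₀ := rfl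
  rw [h, ← Measure.map_map (by fun_prop) (by fun_prop), ← Measure.map_map (by fun_prop) (by fun_prop),
    (measurePreserving_sub_right volume q₀).map_eq, map_continuousLinearEquiv_volume,
    Measure.map_smul, (measurePreserving_sub_right volume η).map_eq, absDet, abs_inv]

theorem integrable_comp_affineHomeo (L : E ≃L[ℝ] E) (q₀ η : E) {h : E → ℝ} (hh : Integrable h) :
    Integrable fun q => h (L (q - q₀) - η) := by
  have := (affineHomeo L q₀ η).measurableEmbedding.integrable_map_iff (μ := volume) (g := h)
  rw [map_affineHomeo_volume] at this
  exact this.1 (hh.smul_measure ENNReal.ofReal_ne_top)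

theorem absDet_mul_integral_comp (L : E ≃L[ℝ] E) (q₀ η : E) (h : E → ℝ) :
    absDet L * ∫ q, h (L (q - q₀) - η) = ∫ x, h x := by
  have := (affineHomeo L q₀ η).measurableEmbedding.integral_map (μ := volume) h
  rw [map_affineHomeo_volume, integral_smul_measure,
    ENNReal.toReal_ofReal (inv_nonneg.2 (absDet_pos L).le)] at this
  simp only [affineHomeo_apply] at this
  rw [← this, smul_eq_mul, ← mul_assoc, mul_inv_cancel₀ (absDet_pos L).ne', one_mul]

/-- The density of an affine image of the standard Gaussian law. -/
theorem map_stdGaussian_eq_withDensity (L : E ≃L[ℝ] E) (q₀ η : E) :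
    (stdGaussian E).map (fun ξ => q₀ + L.symm (ξ + η)) = volume.withDensity
      fun q => ENNReal.ofReal (absDet L * gaussWeight (1 / 2) (L (q - q₀) - η)) := by
  have hT : (fun ξ => q₀ + L.symm (ξ + η)) = (affineHomeo L q₀ η).symm :=
    funext fun x => (affineHomeo_symm_apply L q₀ η x).symm
  set T := affineHomeo L q₀ η with hTdef
  ext s hs
  have hs' : MeasurableSet (T.symm ⁻¹' s) := T.symm.measurable hs
  rw [hT, Measure.map_apply T.symm.measurable hs, stdGaussian_eq_withDensity,
    withDensity_apply _ hs', withDensity_apply _ hs, ← lintegral_indicator hs,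
    ← lintegral_indicator hs']
  set F : E → ENNReal := (T.symm ⁻¹' s).indicator fun x => ENNReal.ofReal (gaussWeight (1 / 2) x)
  have hF : Measurable F :=
    ((continuous_gaussWeight _).measurable.ennreal_ofReal).indicator hs'
  have hind : (s.indicator fun q => ENNReal.ofReal (absDet L * gaussWeight (1 / 2) (L (q - q₀) - η)))
      = fun q => ENNReal.ofReal (absDet L) * F (T q) := by
    funext q
    by_cases hq : q ∈ s
    · have : T q ∈ T.symm ⁻¹' s := by simpa using hq
      simp only [F, Set.indicator_of_mem hq, Set.indicator_of_mem this]
      rw [ENNReal.ofReal_mul (absDet_pos L).le, hTdef, affineHomeo_apply]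
    · have : T q ∉ T.symm ⁻¹' s := by simpa using hq
      simp only [F, Set.indicator_of_notMem hq, Set.indicator_of_notMem this, mul_zero]
  rw [hind]
  change _ = ∫⁻ q, ENNReal.ofReal (absDet L) * F (T q)
  rw [lintegral_const_mul (f := fun q => F (T q)) _ (hF.comp T.measurable), ← lintegral_map hF T.measurable,
    hTdef, map_affineHomeo_volume, lintegral_smul_measure, smul_eq_mul, ← mul_assoc,
    ← ENNReal.ofReal_mul (absDet_pos L).le, mul_inv_cancel₀ (absDet_pos L).ne',
    ENNReal.ofReal_one, one_mul]

/-- Characteristic functions see `B` only through `B Bᵀ`, so any square factor of the covariance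
will do, in particular a multiple of `J⁻¹`. -/
theorem map_stdGaussian_eq_multivariateGaussian {ι : Type*} [Fintype ι] [DecidableEq ι]
    (μ : EuclideanSpace ℝ ι) (B : Matrix ι ι ℝ) :
    (stdGaussian (EuclideanSpace ℝ ι)).map
      (fun x => μ + Matrix.toEuclideanCLM (𝕜 := ℝ) B x)
      = multivariateGaussian μ (B * B.transpose) := by
  have hpsd : (B * B.transpose).PosSemidef := by
    have := Matrix.posSemidef_self_mul_conjTranspose B
    rwa [Matrix.conjTranspose_eq_transpose_of_trivial] at this
  have hprob : IsProbabilityMeasure ((stdGaussian (EuclideanSpace ℝ ι)).map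
      (fun x => μ + Matrix.toEuclideanCLM (𝕜 := ℝ) B x)) :=
    Measure.isProbabilityMeasure_map (by fun_prop)
  refine Measure.ext_of_charFun (funext fun t => ?_)
  rw [charFun_multivariateGaussian hpsd, charFun_apply, integral_map (by fun_prop) (by fun_prop)]
  set t' : EuclideanSpace ℝ ι := Matrix.toEuclideanCLM (𝕜 := ℝ) B.transpose t with ht'
  have hin : ∀ x, inner ℝ (Matrix.toEuclideanCLM (𝕜 := ℝ) B x) t = inner ℝ x t' := by
    intro x
    rw [ht', Matrix.inner_toEuclideanCLM, real_inner_comm, Matrix.inner_toEuclideanCLM,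
      Matrix.dotProduct_mulVec, Matrix.mulVec_transpose, dotProduct_comm]
  have hexp : ∀ x, Complex.exp ((inner ℝ (μ + Matrix.toEuclideanCLM (𝕜 := ℝ) B x) t : ℝ) * Complex.I)
      = Complex.exp ((inner ℝ t μ : ℝ) * Complex.I) * Complex.exp ((inner ℝ x t' : ℝ) * Complex.I) := by
    intro x
    rw [inner_add_left, hin, real_inner_comm μ t, ← Complex.exp_add]
    push_cast
    ring_nf
  simp_rw [hexp]
  rw [integral_const_mul, ← charFun_apply, charFun_stdGaussian, ← Complex.exp_add]
  congr 1
  have hnorm : ‖t'‖ ^ 2 = t.ofLp ⬝ᵥ (B * B.transpose).mulVec t.ofLp := by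
    rw [← real_inner_self_eq_norm_sq, ← hin, real_inner_comm, Matrix.inner_toEuclideanCLM, ht',
      Matrix.ofLp_toEuclideanCLM, Matrix.mulVec_mulVec]
  rw [← hnorm]
  push_cast
  ring

end GaussianDensity

/-! ### Total variation in terms of unnormalised densities -/

section TotalVariation

theorem tvDist_nonneg {X : Type*} [MeasurableSpace X] (μ ν : Measure X) : 0 ≤ tvDist μ ν :=
  Real.iSup_nonneg fun _ => abs_nonneg _

/-- The total variation distance between a measure with density `w / ∫ w` and a probability
measure with density `φ`. -/
theorem tvDist_le_two_mul_integral {X : Type*} [MeasurableSpace X] {lam μ ν : Measure X}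
    {φ w : X → ℝ} (hφ : Integrable φ lam) (hw : Integrable w lam) (hφ0 : ∀ x, 0 ≤ φ x)
    (hw0 : ∀ x, 0 ≤ w x) (hφ1 : ∫ x, φ x ∂lam = 1)
    (hν : ∀ A, MeasurableSet A → ν.real A = ∫ x in A, φ x ∂lam)
    (hμ : ∀ A, MeasurableSet A → μ.real A = (∫ x in A, w x ∂lam) / ∫ x, w x ∂lam) :
    tvDist μ ν ≤ 2 * ∫ x, |w x - φ x| ∂lam := by
  have hne : Nonempty {A : Set X // MeasurableSet A} := ⟨⟨∅, MeasurableSet.empty⟩⟩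
  refine ciSup_le fun ⟨A, hA⟩ => ?_
  simp only
  rw [hν A hA, hμ A hA]
  set Z := ∫ x, w x ∂lam with hZ
  set I := ∫ x, |w x - φ x| ∂lam with hI
  set a := ∫ x in A, w x ∂lam with ha
  set b := ∫ x in A, φ x ∂lam with hb
  have hdiff : Integrable (fun x => w x - φ x) lam := hw.sub hφ
  have hI0 : 0 ≤ I := integral_nonneg fun _ => abs_nonneg _
  have ha0 : 0 ≤ a := integral_nonneg hw0
  have hb0 : 0 ≤ b := integral_nonneg hφ0
  have haZ : a ≤ Z := setIntegral_le_integral hw (ae_of_all _ hw0)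
  have hb1 : b ≤ 1 := hφ1 ▸ setIntegral_le_integral hφ (ae_of_all _ hφ0)
  have hab : |a - b| ≤ I := by
    rw [ha, hb, ← integral_sub hw.integrableOn hφ.integrableOn]
    exact (abs_integral_le_integral_abs).trans
      (setIntegral_le_integral hdiff.abs (ae_of_all _ fun _ => abs_nonneg _))
  have hZ1 : |Z - 1| ≤ I := by
    rw [hZ, ← hφ1, ← integral_sub hw hφ]
    exact abs_integral_le_integral_abs
  have hq0 : 0 ≤ a / Z := div_nonneg ha0 (ha0.trans haZ)
  have hq1 : a / Z ≤ 1 := div_le_one_of_le₀ haZ (ha0.trans haZ)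
  -- If `Z = 0`, then `I ≥ 1` and the bound is trivial. Otherwise the error splits into the
  -- unnormalised difference and the normalisation error `Z - 1`, each at most `I`.
  by_cases hZ0 : Z = 0
  · rw [hZ0] at hZ1
    norm_num at hZ1
    rw [abs_le]
    constructor <;> linarith
  · have h1 : a / Z - b = (a - b) - a / Z * (Z - 1) := by field_simp; ring
    rw [h1]
    refine (abs_sub _ _).trans ?_
    rw [abs_mul, abs_of_nonneg hq0]
    have : a / Z * |Z - 1| ≤ 1 * I := mul_le_mul hq1 hZ1 (abs_nonneg _) zero_le_one
    linarith

theorem measureReal_tilted_withDensity {X : Type*} [MeasurableSpace X] {lam : Measure X}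
    {P : X → ℝ} (hP : Measurable P) (hP0 : ∀ x, 0 ≤ P x) (h : X → ℝ) {A : Set X}
    (hA : MeasurableSet A) :
    ((lam.withDensity fun x => ENNReal.ofReal (P x)).tilted h).real A
      = (∫ x in A, P x * Real.exp (h x) ∂lam) / ∫ x, P x * Real.exp (h x) ∂lam := by
  have hlt : ∀ μ : Measure X, ∀ᵐ x ∂μ, ENNReal.ofReal (P x) < ⊤ := fun μ =>
    ae_of_all _ fun _ => ENNReal.ofReal_lt_top
  have hnn : ∀ x, 0 ≤ P x * Real.exp (h x) := fun x => mul_nonneg (hP0 x) (Real.exp_pos _).le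
  rw [measureReal_def, tilted_apply_eq_ofReal_integral' h hA, integral_div,
    setIntegral_withDensity_eq_setIntegral_toReal_smul hP.ennreal_ofReal (hlt _) _ hA,
    integral_withDensity_eq_integral_toReal_smul hP.ennreal_ofReal (hlt _)]
  simp only [ENNReal.toReal_ofReal (hP0 _), smul_eq_mul]
  exact ENNReal.toReal_ofReal (div_nonneg (integral_nonneg hnn) (integral_nonneg hnn))

end TotalVariation

/-! ### Size of the noise -/

section GaussianNorm

variable {ι : Type*} [Fintype ι]

theorem integral_sq_norm_stdGaussian :
    ∫ x, ‖x‖ ^ 2 ∂(stdGaussian (EuclideanSpace ℝ ι)) = Fintype.card ι := by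
  classical
  have hmp : ∀ i : ι, MeasurePreserving (fun x : EuclideanSpace ℝ ι => x i)
      (stdGaussian (EuclideanSpace ℝ ι)) (gaussianReal 0 1) := fun i => by
    have := measurePreserving_eval_multivariateGaussian (μ := (0 : EuclideanSpace ℝ ι))
      (S := (1 : Matrix ι ι ℝ)) Matrix.PosSemidef.one (i := i)
    simpa using this
  have hsq : Integrable (fun y : ℝ => y ^ 2) (gaussianReal 0 1) := by
    have := (memLp_id_gaussianReal (μ := 0) (v := 1) 2).integrable_sq
    simpa using this
  have hint : ∫ y, y ^ 2 ∂(gaussianReal 0 1) = 1 := by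
    have h := variance_id_gaussianReal (μ := 0) (v := 1)
    rw [variance_of_integral_eq_zero (by fun_prop) (by simp)] at h
    simpa using h
  simp_rw [EuclideanSpace.real_norm_sq_eq]
  rw [integral_finsetSum]
  · have : ∀ i : ι, ∫ x : EuclideanSpace ℝ ι, x i ^ 2 ∂(stdGaussian (EuclideanSpace ℝ ι)) = 1 := by
      intro i
      rw [← hint, ← (hmp i).map_eq, integral_map (by fun_prop) (by fun_prop)]
    simp [this]
  · intro i _
    exact (hmp i).integrable_comp_of_integrable hsq

/-- Markov's inequality for `‖x‖²`, whose mean is the dimension. -/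
theorem stdGaussian_norm_tail {K : ℝ} (hK : 0 < K) [Nonempty ι] :
    stdGaussian (EuclideanSpace ℝ ι) {x | K * √(Fintype.card ι) < ‖x‖}
      ≤ ENNReal.ofReal (1 / K ^ 2) := by
  have hint : Integrable (fun x : EuclideanSpace ℝ ι => ‖x‖ ^ 2)
      (stdGaussian (EuclideanSpace ℝ ι)) := by
    have := (IsGaussian.memLp_two_id (μ := stdGaussian (EuclideanSpace ℝ ι))).integrable_norm_pow
      (by norm_num)
    simpa using this
  have hd : (0 : ℝ) < Fintype.card ι := by exact_mod_cast Fintype.card_pos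
  have h := mul_meas_ge_le_integral_of_nonneg (ae_of_all _ fun x => by positivity) hint
    (K ^ 2 * Fintype.card ι)
  rw [integral_sq_norm_stdGaussian] at h
  have h2 : (stdGaussian (EuclideanSpace ℝ ι)).real {x | K ^ 2 * Fintype.card ι ≤ ‖x‖ ^ 2}
      ≤ 1 / K ^ 2 := by
    rw [le_div_iff₀ (by positivity)]
    refine le_of_mul_le_mul_right ?_ hd
    linarith
  refine (measure_mono fun x hx => ?_).trans ((ENNReal.le_ofReal_iff_toReal_le
    (measure_ne_top _ _) (by positivity)).2 h2)
  have hx' : K * √(Fintype.card ι) < ‖x‖ := hx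
  have := pow_le_pow_left₀ (by positivity) hx'.le 2
  rwa [mul_pow, Real.sq_sqrt hd.le] at this

end GaussianNorm

/-! ### Regularity of the prior density -/

section PriorDensity

variable {a b : ℝ} {m : ℕ}

theorem IsComponentDensity.nonneg {p : ℝ → ℝ} (hp : IsComponentDensity a b p) (x : ℝ) :
    0 ≤ p x := by
  by_cases hx : x ∈ Set.Icc a b
  · exact (hp.pos x hx).le
  · rw [hp.eq_zero x hx]

theorem IsComponentDensity.integrable {p : ℝ → ℝ} (hp : IsComponentDensity a b p) :
    Integrable p := by
  refine ⟨hp.measurable.aestronglyMeasurable, ?_⟩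
  rw [hasFiniteIntegral_iff_ofReal (ae_of_all _ hp.nonneg), hp.lintegral_eq_one]
  exact ENNReal.one_lt_top

theorem measurable_prod_density {p : Grid m → ℝ → ℝ} (hp : ∀ i, IsComponentDensity a b (p i)) :
    Measurable fun q : GridVec m => ∏ i, p i (q i) :=
  Finset.measurable_prod _ fun i _ => (hp i).measurable.comp (by fun_prop)

theorem integrable_prod_density {p : Grid m → ℝ → ℝ} (hp : ∀ i, IsComponentDensity a b (p i)) :
    Integrable fun q : GridVec m => ∏ i, p i (q i) := by
  have h : Integrable (fun x : Grid m → ℝ => ∏ i, p i (x i)) :=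
    Integrable.fintype_prod fun i => (hp i).integrable
  exact (PiLp.volume_preserving_ofLp (Grid m)).integrable_comp_of_integrable h

end PriorDensity

/-! ### Density of the limiting normal law -/

section NormalApproximation

/-- The linear equivalence `q ↦ √n J q` attached to an invertible Jacobian matrix `J`. -/
theorem exists_scaled_equiv {ι : Type*} [Fintype ι] [DecidableEq ι] {J : Matrix ι ι ℝ}
    (hJ : IsUnit J.det) {r : ℝ} (hr : r ≠ 0) :
    ∃ L : EuclideanSpace ℝ ι ≃L[ℝ] EuclideanSpace ℝ ι,
      (∀ v, L v = r • Matrix.toEuclideanCLM (𝕜 := ℝ) J v) ∧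
      ∀ v, L.symm v = r⁻¹ • Matrix.toEuclideanCLM (𝕜 := ℝ) J⁻¹ v := by
  have h1 : ∀ A B : Matrix ι ι ℝ, A * B = 1 → ∀ v, Matrix.toEuclideanCLM (𝕜 := ℝ) A
      (Matrix.toEuclideanCLM (𝕜 := ℝ) B v) = v := by
    intro A B hAB v
    rw [← mul_apply_eq_comp, ← map_mul, hAB, map_one]; rfl
  refine ⟨ContinuousLinearEquiv.equivOfInverse (r • Matrix.toEuclideanCLM (𝕜 := ℝ) J)
    (r⁻¹ • Matrix.toEuclideanCLM (𝕜 := ℝ) J⁻¹) (fun v => ?_) (fun v => ?_), fun v => rfl,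
    fun v => rfl⟩
  · simp only [smul_apply, map_smul, smul_smul, mul_inv_cancel₀ hr, one_smul,
      h1 _ _ (Matrix.nonsing_inv_mul _ hJ)]
  · simp only [smul_apply, map_smul, smul_smul, inv_mul_cancel₀ hr, one_smul,
      h1 _ _ (Matrix.mul_nonsing_inv _ hJ)]

/-- For square invertible `J` one has `Σ Jᵀ = J⁻¹`, so the normal law is that of `q₀ + L⁻¹ (ξ + η)`
with `ξ` standard Gaussian. -/
theorem normalApprox_eq_withDensity {m : ℕ} {G : GridVec m → GridVec m} {n : ℕ} (hn : 0 < n)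
    {q₀ : GridVec m} (η : GridVec m) (hJ : IsUnit (jacobian G q₀).det)
    {L : GridVec m ≃L[ℝ] GridVec m}
    (hL : ∀ v, L.symm v = (√n)⁻¹ • Matrix.toEuclideanCLM (𝕜 := ℝ) (jacobian G q₀)⁻¹ v) :
    normalApprox G n q₀ η = volume.withDensity
      fun q => ENNReal.ofReal (absDet L * gaussWeight (1 / 2) (L (q - q₀) - η)) := by
  set J := jacobian G q₀ with hJdef
  have hJt : IsUnit J.transpose.det := by rwa [Matrix.det_transpose]
  have hcov : limitCov G q₀ = J⁻¹ * (J⁻¹).transpose := by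
    rw [limitCov, ← hJdef, Matrix.mul_inv_rev, Matrix.transpose_nonsing_inv]
  have hcov' : limitCov G q₀ * J.transpose = J⁻¹ := by
    rw [hcov, Matrix.mul_assoc, Matrix.transpose_nonsing_inv, Matrix.nonsing_inv_mul _ hJt,
      Matrix.mul_one]
  have hcentre : centre G n q₀ η = q₀ + L.symm η := by
    rw [centre, ← hJdef, hcov', hL]; rfl
  have hn' : (0 : ℝ) < n := by exact_mod_cast hn
  set B : Matrix (Grid m) (Grid m) ℝ := (√n)⁻¹ • J⁻¹ with hB
  have hBB : B * B.transpose = (n : ℝ)⁻¹ • limitCov G q₀ := by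
    rw [hB, Matrix.transpose_smul, Matrix.smul_mul, Matrix.mul_smul, smul_smul, hcov, ← mul_inv,
      Real.mul_self_sqrt hn'.le]
  rw [normalApprox, ← hBB, ← map_stdGaussian_eq_multivariateGaussian,
    ← map_stdGaussian_eq_withDensity, hcentre]
  congr 1
  funext ξ
  rw [map_add, hL ξ, hB, map_smul, smul_apply]
  abel

end NormalApproximation

/-! ### Pointwise comparison of posterior and Gaussian densities -/

section WeightComparison

/-- The normalising constant of the standard Gaussian density. -/
noncomputable def gaussNorm (m : ℕ) : ℝ :=
  ((Real.pi / (1 / 2)) ^ (Module.finrank ℝ (GridVec m) / 2 : ℝ))⁻¹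

theorem gaussNorm_pos (m : ℕ) : 0 < gaussNorm m := by
  have := Real.pi_pos
  unfold gaussNorm; positivity

theorem gaussWeight_half {m : ℕ} (x : GridVec m) :
    gaussWeight (1 / 2) x = gaussNorm m * Real.exp (-(‖x‖ ^ 2 / 2)) := by
  rw [gaussWeight, gaussNorm]; ring_nf

/-- Relative to the standard normalisation the flatter Gaussian costs `(2 b) ^ (d / 2)`. This
factor, exponential in `d = m²`, is why the scalar bounds carry a free `θ`. -/
theorem gaussWeight_eq_gaussNorm_mul {m : ℕ} {b : ℝ} (hb : 0 < b) (x : GridVec m) :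
    gaussWeight b x = gaussNorm m *
      (Real.exp (-(-Real.log (2 * b) / 2) * (m : ℝ) ^ 2) * Real.exp (-b * ‖x‖ ^ 2)) := by
  have hpi := Real.pi_pos
  have hd : (Module.finrank ℝ (GridVec m) : ℝ) = (m : ℝ) ^ 2 := by simp [sq]
  rw [gaussWeight, gaussNorm, ← mul_assoc, hd]
  congr 1
  have h1 : Real.exp (-(-Real.log (2 * b) / 2) * (m : ℝ) ^ 2) = (2 * b) ^ ((m : ℝ) ^ 2 / 2) := by
    rw [Real.rpow_def_of_pos (by positivity)]; ring_nf
  rw [h1, ← Real.inv_rpow (by positivity), ← Real.inv_rpow (by positivity),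
    ← Real.mul_rpow (by positivity) (by positivity)]
  congr 1
  field_simp

/-- The intended reading is `v = q - q₀`, `z = √n J v`, `s = √n (G q - G q₀)`, and `l` the log prior
ratio. The second clause serves `q` outside the box, where the posterior density vanishes. -/
theorem exists_abs_weight_sub_le {K D c ρ : ℝ} (hK : 0 ≤ K) (hD : 0 ≤ D) (hc : 0 ≤ c)
    (hρ : 0 < ρ) :
    ∃ C > 0, ∀ (m : ℕ) (τ : ℝ) (η z : GridVec m), 1 ≤ m → 0 ≤ τ → τ * (m : ℝ) ^ 3 ≤ 1 →
      ‖η‖ ≤ K * m →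
      (∀ (s v : GridVec m) (l : ℝ), ‖v‖ ≤ τ * ‖z‖ → ‖s - z‖ ≤ ‖v‖ * ‖z‖ → ‖s - z‖ ≤ D * ‖z‖ →
        ‖z‖ ≤ (1 + D) * ‖s‖ → |l| ≤ c * m * ‖v‖ → |l| ≤ c * (m : ℝ) ^ 2 →
        |gaussNorm m * (Real.exp l * Real.exp (-(‖η - s‖ ^ 2 / 2))) - gaussWeight (1 / 2) (z - η)|
          ≤ C * (τ * (m : ℝ) ^ 3) *
            (gaussWeight (1 / 2) (z - η) + gaussWeight (1 / (32 * (1 + D) ^ 2)) z)) ∧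
      (ρ ≤ τ * ‖z‖ → gaussWeight (1 / 2) (z - η) ≤ C * (τ * (m : ℝ) ^ 3) *
            (gaussWeight (1 / 2) (z - η) + gaussWeight (1 / (32 * (1 + D) ^ 2)) z)) := by
  set b := 1 / (32 * (1 + D) ^ 2) with hb
  have hb0 : 0 < b := by positivity
  obtain ⟨C₁, hC₁, h₁⟩ := exists_abs_exp_sub_exp_le hK hD hc (-Real.log (2 * b) / 2)
  obtain ⟨C₂, hC₂, h₂⟩ := exists_exp_neg_le hK hρ hD (-Real.log (2 * b) / 2)
  refine ⟨C₁ + C₂, by positivity, ?_⟩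
  intro m τ η z hm hτ hτm hη
  have hm' : (1 : ℝ) ≤ m := by exact_mod_cast hm
  have hN := gaussNorm_pos m
  rw [gaussWeight_half, gaussWeight_eq_gaussNorm_mul hb0]
  set X := Real.exp (-(-Real.log (2 * b) / 2) * (m : ℝ) ^ 2) * Real.exp (-b * ‖z‖ ^ 2) with hX
  set E := Real.exp (-(‖z - η‖ ^ 2 / 2)) with hE
  have hX0 : 0 < X := by positivity
  have hE0 : 0 < E := Real.exp_pos _
  have htail : ∀ y : GridVec m, ‖η‖ ≤ ‖y‖ / 2 → ‖y‖ ^ 2 / 8 ≤ ‖y - η‖ ^ 2 / 2 := by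
    intro y hy
    have h1 : ‖y‖ / 2 ≤ ‖y - η‖ := by linarith [norm_sub_norm_le y η]
    have h2 := pow_le_pow_left₀ (by positivity) h1 2
    linarith
  have hfin : ∀ C' ≤ C₁ + C₂, C' * (τ * (m : ℝ) ^ 3) * (E + X) * gaussNorm m
      ≤ (C₁ + C₂) * (τ * (m : ℝ) ^ 3) * (gaussNorm m * E + gaussNorm m * X) := by
    intro C' hC'
    calc _ ≤ (C₁ + C₂) * (τ * (m : ℝ) ^ 3) * (E + X) * gaussNorm m := by gcongr
      _ = _ := by ring
  constructor
  · intro s v l hv hs1 hs2 hzs hl1 hl2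
    have hez : |‖η - s‖ ^ 2 / 2 - ‖z - η‖ ^ 2 / 2| ≤ ‖v‖ * ‖z‖ * (2 * ‖η‖ + (2 + D) * ‖z‖) / 2 := by
      have e1 : ‖η - s‖ ^ 2 / 2 - ‖z - η‖ ^ 2 / 2
          = (‖η - s‖ - ‖η - z‖) * (‖η - s‖ + ‖η - z‖) / 2 := by rw [norm_sub_rev z η]; ring
      have e2 : |‖η - s‖ - ‖η - z‖| ≤ ‖v‖ * ‖z‖ := by
        refine (abs_norm_sub_norm_le _ _).trans (le_trans (le_of_eq ?_) hs1)
        rw [← norm_neg]; congr 1; abel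
      have e3 : ‖η - s‖ + ‖η - z‖ ≤ 2 * ‖η‖ + (2 + D) * ‖z‖ := by
        have h3 : ‖s‖ ≤ ‖s - z‖ + ‖z‖ := by simpa using norm_add_le (s - z) z
        linarith [norm_sub_le η s, norm_sub_le η z]
      rw [e1, abs_div, abs_mul, abs_of_nonneg (show 0 ≤ ‖η - s‖ + ‖η - z‖ by positivity),
        abs_of_pos (zero_lt_two' ℝ)]
      gcongr
    have h := h₁ m τ ‖η‖ ‖v‖ ‖z‖ ‖s‖ l (‖η - s‖ ^ 2 / 2) (‖z - η‖ ^ 2 / 2) hm' hτ hτm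
      (norm_nonneg _) hη (norm_nonneg _) hv (norm_nonneg _) hzs hl1 hl2 hez
      (by rw [norm_sub_rev η s]; exact htail s) (htail z)
    rw [← Real.exp_add, ← sub_eq_add_neg, ← mul_sub, abs_mul, abs_of_pos hN, mul_comm]
    exact (mul_le_mul_of_nonneg_right h hN.le).trans (hfin C₁ (by linarith))
  · intro hz
    have h := h₂ m τ ‖η‖ ‖z‖ (‖z - η‖ ^ 2 / 2) hm' hτ (norm_nonneg _) hη (norm_nonneg _) hz (htail z)
    rw [mul_comm (gaussNorm m) E]
    refine (mul_le_mul_of_nonneg_right h hN.le).trans ?_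
    rw [mul_comm E (gaussNorm m)]
    exact hfin C₂ (by linarith)

end WeightComparison

/-! ### The log prior ratio -/

section LogPrior

theorem prod_density_eq_mul_exp {a b : ℝ} {m : ℕ} {p : Grid m → ℝ → ℝ}
    (hp : ∀ i, IsComponentDensity a b (p i)) {q q₀ : GridVec m} (hq : ∀ i, q i ∈ Set.Icc a b)
    (hq₀ : ∀ i, q₀ i ∈ Set.Icc a b) :
    ∏ i, p i (q i)
      = (∏ i, p i (q₀ i)) * Real.exp (∑ i, (Real.log (p i (q i)) - Real.log (p i (q₀ i)))) := by
  rw [Real.exp_sum, ← Finset.prod_mul_distrib]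
  refine Finset.prod_congr rfl fun i _ => ?_
  have h1 := (hp i).pos _ (hq i)
  have h2 := (hp i).pos _ (hq₀ i)
  rw [Real.exp_sub, Real.exp_log h1, Real.exp_log h2]
  field_simp

theorem sum_abs_le_mul_norm {m : ℕ} (v : GridVec m) : ∑ i, |v i| ≤ m * ‖v‖ := by
  refine le_of_sq_le_sq ?_ (by positivity)
  have h := sq_sum_le_card_mul_sum_sq (s := Finset.univ) (f := fun i => |v i|)
  rw [mul_pow, EuclideanSpace.real_norm_sq_eq]
  simpa [sq_abs, sq] using h

/-- Near `q₀` the first bound, from Cauchy–Schwarz with `√d = m`, gives smallness; far away the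
second is the one that Gaussian decay absorbs. -/
theorem abs_sum_log_sub_le {a b C : ℝ} (hC : 0 ≤ C) {m : ℕ} {p : Grid m → ℝ → ℝ}
    (hlip : ∀ i, ∀ x ∈ Set.Icc a b, ∀ y ∈ Set.Icc a b,
      |Real.log (p i x) - Real.log (p i y)| ≤ C * |x - y|)
    {q q₀ : GridVec m} (hq : ∀ i, q i ∈ Set.Icc a b) (hq₀ : ∀ i, q₀ i ∈ Set.Icc a b) :
    |∑ i, (Real.log (p i (q i)) - Real.log (p i (q₀ i)))| ≤ C * m * ‖q - q₀‖ ∧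
    |∑ i, (Real.log (p i (q i)) - Real.log (p i (q₀ i)))| ≤ C * (b - a) * (m : ℝ) ^ 2 := by
  have h1 : |∑ i, (Real.log (p i (q i)) - Real.log (p i (q₀ i)))| ≤ C * ∑ i, |(q - q₀) i| := by
    rw [Finset.mul_sum]
    exact (Finset.abs_sum_le_sum_abs _ _).trans
      (Finset.sum_le_sum fun i _ => hlip i _ (hq i) _ (hq₀ i))
  refine ⟨h1.trans ?_, h1.trans ?_⟩
  · rw [mul_assoc]
    exact mul_le_mul_of_nonneg_left (sum_abs_le_mul_norm _) hC
  · rw [mul_assoc]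
    refine mul_le_mul_of_nonneg_left ?_ hC
    calc ∑ i, |(q - q₀) i| ≤ ∑ _i : Grid m, (b - a) := Finset.sum_le_sum fun i _ => by
          rw [PiLp.sub_apply, abs_le]
          constructor <;> linarith [(hq i).1, (hq i).2, (hq₀ i).1, (hq₀ i).2]
      _ = _ := by simp; ring

end LogPrior

/-! ### The nonasymptotic bound and the theorem -/

section BernsteinVonMises

variable {f g : ℝ × ℝ → ℝ}

/-- The observed log-likelihood in terms of the rescaled increment of the forward map. -/
theorem neg_half_mul_norm_observation_sub_sq {m : ℕ} (G : GridVec m → GridVec m) {n : ℕ}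
    (hn : 0 < n) (q₀ η q : GridVec m) :
    -((n : ℝ) / 2) * ‖observation G n q₀ η - G q‖ ^ 2 = -(‖η - √n • (G q - G q₀)‖ ^ 2 / 2) := by
  have hn' : (0 : ℝ) < n := by exact_mod_cast hn
  have hr : √(n : ℝ) ≠ 0 := (Real.sqrt_pos.2 hn').ne'
  have h : η - √n • (G q - G q₀) = √n • (observation G n q₀ η - G q) := by
    rw [observation, smul_sub, smul_sub, smul_add, smul_smul, mul_inv_cancel₀ hr, one_smul]
    abel
  rw [h, norm_smul, mul_pow, Real.norm_of_nonneg (Real.sqrt_nonneg _), Real.sq_sqrt hn'.le]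
  ring

/-- A nonasymptotic Bernstein–von Mises bound for the discretised inverse problem, on the event
that the noise has norm of the order of the square root of the dimension. -/
theorem exists_tvDist_posterior_le {c₀ qmin qmax ρ C₁ K : ℝ} (hc₀ : 0 < c₀)
    (hf : ∀ x ∈ unitSquare, c₀ ≤ f x) (hg : ∀ x ∈ frontier unitSquare, c₀ ≤ g x)
    (hqmin : 0 ≤ qmin) (hq : qmin ≤ qmax) (hρ : 0 < ρ) (hC₁ : 0 ≤ C₁) (hK : 0 ≤ K) :
    ∃ C > 0, ∃ b > 0, ∀ (m n : ℕ) (q₀ η : GridVec m) (p : Grid m → ℝ → ℝ), 1 ≤ m → 0 < n →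
      (∀ i, q₀ i ∈ Set.Icc (qmin + ρ) (qmax - ρ)) → (∀ i, IsComponentDensity qmin qmax (p i)) →
      (∀ i, ∀ x ∈ Set.Icc qmin qmax, ∀ y ∈ Set.Icc qmin qmax,
        |Real.log (p i x) - Real.log (p i y)| ≤ C₁ * |x - y|) →
      ‖η‖ ≤ K * m → b * ((m : ℝ) ^ 5 / √n) ≤ 1 →
      tvDist (gridPosterior (forwardMap f g m) n (observation (forwardMap f g m) n q₀ η)
          (productPrior p)) (normalApprox (forwardMap f g m) n q₀ η)
        ≤ C * ((m : ℝ) ^ 5 / √n) := by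
  set D := qmax - qmin with hD
  have hD0 : 0 ≤ D := sub_nonneg.2 hq
  have hqmax : 0 ≤ qmax := hqmin.trans hq
  set b₀ := 1 / (32 * (1 + D) ^ 2) with hb₀
  have hb₀p : 0 < b₀ := by positivity
  obtain ⟨C, hC, hweight⟩ := exists_abs_weight_sub_le (K := K) (D := D) (c := C₁ * (1 + D))
    (ρ := ρ) hK hD0 (by positivity) hρ
  set c := c₀ / (1 + qmax) with hc
  have hcp : 0 < c := by positivity
  set b := (32 + qmax) / c with hb
  have hbp : 0 < b := by positivity
  -- A factor `2` comes from normalisation in total variation, another `2` from the mass of `φ + χ`,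
  -- and `b` from `τ m³ = b m⁵ / √n`.
  refine ⟨4 * C * b, by positivity, b, hbp, ?_⟩
  intro m n q₀ η p hm hn hq₀ hp hlip hη hrate
  have hn' : (0 : ℝ) < n := by exact_mod_cast hn
  set r := √(n : ℝ) with hr
  have hr0 : 0 < r := Real.sqrt_pos.2 hn'
  have hq₀F : ∀ i, q₀ i ∈ Set.Icc qmin qmax := fun i =>
    ⟨by linarith [(hq₀ i).1], by linarith [(hq₀ i).2]⟩
  have hq₀pos : ∀ i, 0 < q₀ i := fun i => by linarith [(hq₀ i).1]
  have hu : ∀ i, c ≤ forwardMap f g m q₀ i := forwardMap_lower_bound hc₀ hqmax hf hg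
    fun i => ⟨(hq₀pos i).le, (hq₀F i).2⟩
  set G := forwardMap f g m with hG
  set J := forwardDeriv f g m q₀ with hJ
  have hjac : jacobian G q₀ = forwardJacobian f g m q₀ := jacobian_forwardMap hq₀pos
  have hdet : IsUnit (jacobian G q₀).det := by
    rw [hjac]
    exact isUnit_det_forwardJacobian (fun i => (hq₀pos i).le) fun i => (hcp.trans_le (hu i)).ne'
  obtain ⟨L, hL, hLsymm⟩ := exists_scaled_equiv hdet hr0.ne'
  have hLJ : ∀ v, L v = r • J v := fun v => by rw [hL, hjac]; rfl
  -- This bounds the norm of `L⁻¹`, where `L = √n J`.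
  set τ := b * (m : ℝ) ^ 2 / r with hτ
  have hτ0 : 0 ≤ τ := by positivity
  have hτm : τ * (m : ℝ) ^ 3 = b * ((m : ℝ) ^ 5 / r) := by rw [hτ]; ring
  have hnormv : ∀ v : GridVec m, ‖v‖ ≤ τ * ‖L v‖ := by
    intro v
    have h := le_norm_forwardDeriv hm hcp.le (fun i => ⟨(hq₀pos i).le, (hq₀F i).2⟩) hqmax hu v
    rw [hLJ, norm_smul, Real.norm_of_nonneg hr0.le, hτ, hb]
    have h2 : (32 + qmax) / c * (m : ℝ) ^ 2 / r * (r * ‖J v‖)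
        = (32 + qmax) * (m : ℝ) ^ 2 * ‖J v‖ / c := by field_simp
    rw [h2, le_div_iff₀ hcp, mul_comm]
    exact h
  set φ : GridVec m → ℝ := fun q => absDet L * gaussWeight (1 / 2) (L (q - q₀) - η) with hφ
  set χ : GridVec m → ℝ := fun q => absDet L * gaussWeight b₀ (L (q - q₀) - 0) with hχ
  set π₀ := ∏ i, p i (q₀ i) with hπ₀
  have hπ₀p : 0 < π₀ := Finset.prod_pos fun i _ => (hp i).pos _ (hq₀F i)
  -- Scaling does not affect the posterior; this one cancels the prior density at `q₀` and matches
  -- the normalising constant of `φ`.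
  set k := absDet L * gaussNorm m / π₀ with hk
  have hdetL := absDet_pos L
  have hkp : 0 < k := by have := gaussNorm_pos m; positivity
  set h : GridVec m → ℝ := fun q => -((n : ℝ) / 2) * ‖observation G n q₀ η - G q‖ ^ 2 with hh
  set P : GridVec m → ℝ := fun q => ∏ i, p i (q i) with hP
  have hP0 : ∀ q, 0 ≤ P q := fun q => Finset.prod_nonneg fun i _ => (hp i).nonneg _
  have hPm : Measurable P := measurable_prod_density hp
  set w : GridVec m → ℝ := fun q => k * (P q * Real.exp (h q)) with hw
  have hGm : Measurable G := measurable_forwardMap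
  have hhm : Measurable h := (((measurable_const.sub hGm).norm).pow_const 2).const_mul _
  have hwi : Integrable w := by
    refine Integrable.const_mul ?_ _
    refine (integrable_prod_density hp).mono (hPm.mul hhm.exp).aestronglyMeasurable
      (ae_of_all _ fun q => ?_)
    rw [norm_mul, Real.norm_of_nonneg (Real.exp_pos _).le]
    refine mul_le_of_le_one_right (norm_nonneg _) (Real.exp_le_one_iff.2 ?_)
    have : 0 ≤ (n : ℝ) / 2 * ‖observation G n q₀ η - G q‖ ^ 2 := by positivity
    simp only [hh]; linarith
  have hw0 : ∀ q, 0 ≤ w q := fun q =>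
    mul_nonneg hkp.le (mul_nonneg (hP0 q) (Real.exp_pos _).le)
  have hφi : Integrable φ :=
    (integrable_comp_affineHomeo L q₀ η (integrable_gaussWeight (by norm_num))).const_mul _
  have hχi : Integrable χ :=
    (integrable_comp_affineHomeo L q₀ 0 (integrable_gaussWeight hb₀p)).const_mul _
  have hφ1 : ∫ q, φ q = 1 := by
    rw [hφ, integral_const_mul, absDet_mul_integral_comp, integral_gaussWeight (by norm_num)]
  have hχ1 : ∫ q, χ q = 1 := by
    rw [hχ, integral_const_mul, absDet_mul_integral_comp, integral_gaussWeight hb₀p]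
  have hφ0 : ∀ q, 0 ≤ φ q := fun q =>
    mul_nonneg hdetL.le (gaussWeight_pos (by norm_num) _).le
  have hpoint : ∀ q, |w q - φ q| ≤ C * (τ * (m : ℝ) ^ 3) * (φ q + χ q) := by
    intro q
    obtain ⟨hin, hout⟩ := hweight m τ η (L (q - q₀)) hm hτ0 (by rw [hτm]; exact hrate) hη
    have hrhs : C * (τ * (m : ℝ) ^ 3) * (φ q + χ q) = absDet L * (C * (τ * (m : ℝ) ^ 3) *
        (gaussWeight (1 / 2) (L (q - q₀) - η) + gaussWeight b₀ (L (q - q₀)))) := by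
      simp only [hφ, hχ, sub_zero]; ring
    rw [hrhs]
    by_cases hqF : ∀ i, q i ∈ Set.Icc qmin qmax
    · have hqpos : ∀ i, 0 ≤ q i := fun i => hqmin.trans (hqF i).1
      have hq₀' : ∀ i, 0 ≤ q₀ i := fun i => (hq₀pos i).le
      have hsup : ∀ i, |(q - q₀) i| ≤ ‖q - q₀‖ := fun i => by
        rw [← Real.norm_eq_abs]; exact PiLp.norm_apply_le _ _
      have hsupD : ∀ i, |(q - q₀) i| ≤ D := fun i => by
        rw [PiLp.sub_apply, abs_le, hD]
        constructor <;> linarith [(hqF i).1, (hqF i).2, (hq₀F i).1, (hq₀F i).2]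
      set s := r • (G q - G q₀) with hs
      have hsz : s - L (q - q₀) = r • (G q - G q₀ - J (q - q₀)) := by
        rw [hs, hLJ, ← smul_sub]
      have hszle : ∀ B : ℝ, 0 ≤ B → (∀ i, |(q - q₀) i| ≤ B) →
          ‖s - L (q - q₀)‖ ≤ B * ‖L (q - q₀)‖ := by
        intro B hB hBq
        have h1 := norm_forwardMap_sub_sub_le (f := f) (g := g) hq₀' hqpos hB hBq
        rw [hsz, hLJ, norm_smul, norm_smul, Real.norm_of_nonneg hr0.le, mul_left_comm]
        exact mul_le_mul_of_nonneg_left h1 hr0.le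
      have hzs : ‖L (q - q₀)‖ ≤ (1 + D) * ‖s‖ := by
        have h1 := norm_forwardDeriv_le (f := f) (g := g) hq₀' hqpos hD0 hsupD
        rw [hs, hLJ, norm_smul, norm_smul, Real.norm_of_nonneg hr0.le, mul_left_comm]
        exact mul_le_mul_of_nonneg_left h1 hr0.le
      obtain ⟨hl1, hl2⟩ := abs_sum_log_sub_le hC₁ hlip hqF hq₀F
      have hl1' := hl1.trans (show C₁ * m * ‖q - q₀‖ ≤ C₁ * (1 + D) * m * ‖q - q₀‖ by
        gcongr; exact le_mul_of_one_le_right hC₁ (by linarith))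
      have hl2' := hl2.trans (show C₁ * (qmax - qmin) * (m : ℝ) ^ 2
          ≤ C₁ * (1 + D) * (m : ℝ) ^ 2 by gcongr; linarith)
      have hmain := hin s (q - q₀) _ (hnormv _) (hszle _ (norm_nonneg _) hsup)
        (hszle D hD0 hsupD) hzs hl1' hl2'
      have hwq : w q = absDet L * (gaussNorm m * (Real.exp
          (∑ i, (Real.log (p i (q i)) - Real.log (p i (q₀ i)))) *
          Real.exp (-(‖η - s‖ ^ 2 / 2)))) := by
        simp only [hw, hP, hh, hk]
        rw [prod_density_eq_mul_exp hp hqF hq₀F, neg_half_mul_norm_observation_sub_sq G hn, ← hπ₀]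
        field_simp
        rfl
      rw [hwq, show φ q = absDet L * gaussWeight (1 / 2) (L (q - q₀) - η) from rfl, ← mul_sub,
        abs_mul, abs_of_pos hdetL]
      exact mul_le_mul_of_nonneg_left hmain hdetL.le
    · push Not at hqF
      obtain ⟨i, hi⟩ := hqF
      have hwq : w q = 0 := by
        have : P q = 0 := Finset.prod_eq_zero (Finset.mem_univ i) ((hp i).eq_zero _ hi)
        simp only [hw, this, zero_mul, mul_zero]
      -- Leaving the box means that some coordinate has moved by more than the margin of `q₀`.
      have hρle : ρ ≤ ‖q - q₀‖ := by
        refine le_trans ?_ (PiLp.norm_apply_le (q - q₀) i)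
        rw [Real.norm_eq_abs, PiLp.sub_apply, le_abs]
        by_contra! hcon
        exact hi ⟨by linarith [(hq₀ i).1], by linarith [(hq₀ i).2]⟩
      have hmain := hout (hρle.trans (hnormv _))
      rw [hwq, zero_sub, abs_neg, abs_of_nonneg (hφ0 q)]
      exact mul_le_mul_of_nonneg_left hmain hdetL.le
  have hint : ∫ q, |w q - φ q| ≤ 2 * (C * (τ * (m : ℝ) ^ 3)) := by
    calc ∫ q, |w q - φ q| ≤ ∫ q, C * (τ * (m : ℝ) ^ 3) * (φ q + χ q) :=
          integral_mono (hwi.sub hφi).abs ((hφi.add hχi).const_mul _) hpoint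
      _ = _ := by rw [integral_const_mul, integral_add hφi hχi, hφ1, hχ1]; ring
  have htv := tvDist_le_two_mul_integral (lam := volume)
    (μ := gridPosterior G n (observation G n q₀ η) (productPrior p))
    (ν := normalApprox G n q₀ η) hφi hwi hφ0 hw0 hφ1 (fun A hA => ?_) (fun A hA => ?_)
  · refine htv.trans ?_
    rw [hτm] at hint
    linarith
  · rw [normalApprox_eq_withDensity hn η hdet hLsymm, measureReal_def, withDensity_apply _ hA,
      ← ofReal_integral_eq_lintegral_ofReal hφi.integrableOn (ae_of_all _ hφ0)]
    exact ENNReal.toReal_ofReal (integral_nonneg hφ0)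
  · have := measureReal_tilted_withDensity (lam := volume) hPm hP0 h hA
    rw [gridPosterior, productPrior]
    rw [this]
    simp only [hw]
    rw [integral_const_mul, integral_const_mul, mul_div_mul_left _ _ hkp.ne']

end BernsteinVonMises

/-- The spare factor `m log (m²)` is at least `1` once `m ≥ 2`. -/
theorem pow_five_div_sqrt_le_bvmRate {m : ℕ} (hm : 2 ≤ m) (n : ℕ) :
    (m : ℝ) ^ 5 / √n ≤ bvmRate n m := by
  have hm' : (2 : ℝ) ≤ m := by exact_mod_cast hm
  have h1 : 1 ≤ (m : ℝ) * Real.log ((m : ℝ) ^ 2) := by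
    have h2 := Real.log_two_gt_d9
    have h3 : Real.log 2 ≤ Real.log m := Real.log_le_log (by norm_num) hm'
    rw [Real.log_pow]
    push_cast
    nlinarith
  have h4 : 0 ≤ (√(n : ℝ))⁻¹ * (m : ℝ) ^ 5 := by positivity
  rw [bvmRate]
  calc (m : ℝ) ^ 5 / √n = (√(n : ℝ))⁻¹ * (m : ℝ) ^ 5 * 1 := by ring
    _ ≤ (√(n : ℝ))⁻¹ * (m : ℝ) ^ 5 * ((m : ℝ) * Real.log ((m : ℝ) ^ 2)) := by gcongr
    _ = _ := by ring

theorem theorem2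
    -- the boundary value problem
    (f g : ℝ × ℝ → ℝ)
    (hf_cont : ContinuousOn f unitSquare) (hf_pos : ∀ x ∈ unitSquare, 0 < f x)
    (hg_cont : ContinuousOn g (frontier unitSquare)) (hg_pos : ∀ x ∈ frontier unitSquare, 0 < g x)
    (qmin qmax : ℝ) (hqmin : 0 ≤ qmin)
    -- `d n = (m n) ^ 2` is the dimension, at least two
    (m : ℕ → ℕ) (hm : ∀ n, 2 ≤ m n)
    -- the truth, inside `[qmin, qmax] ^ d` with a margin that does not depend on `n`
    (q₀ : ∀ n, GridVec (m n))
    (ρ : ℝ) (hρ : 0 < ρ) (hq₀ : ∀ n i, q₀ n i ∈ Set.Icc (qmin + ρ) (qmax - ρ))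
    -- the prior
    (p : ∀ n, Grid (m n) → ℝ → ℝ) (hp : PriorAssumptions qmin qmax p)
    -- the noise
    {Ω : Type*} [MeasurableSpace Ω] (P : Measure Ω) [IsProbabilityMeasure P]
    (η : ∀ n, Ω → GridVec (m n))
    (hη : ∀ n, HasLaw (η n) (stdGaussian (GridVec (m n))) P)
    -- the growth condition
    (hrate : Tendsto (fun n => bvmRate n (m n)) atTop (𝓝 0)) :
    IsBigOInProbability P
      (fun n ω =>
        tvDist
          (gridPosterior (forwardMap f g (m n)) n
            (observation (forwardMap f g (m n)) n (q₀ n) (η n ω)) (productPrior (p n)))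
          (normalApprox (forwardMap f g (m n)) n (q₀ n) (η n ω)))
      (fun n => bvmRate n (m n)) := by
  intro ε hε
  obtain ⟨c₀, hc₀, hf, hg⟩ := exists_lower_bounds hf_cont hf_pos hg_cont hg_pos
  have hq : qmin + ρ ≤ qmax - ρ := by
    have i : Fin (m 0) := ⟨0, by linarith [hm 0]⟩
    exact (hq₀ 0 (i, i)).1.trans (hq₀ 0 (i, i)).2
  -- Taking `δ` to be the full width makes the Lipschitz bound valid on the whole interval.
  obtain ⟨C₁, hC₁, hlip⟩ := hp.log_lipschitz (qmax - qmin) (by linarith)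
  -- Chosen so that the noise exceeds `K m` with probability at most `1 / K² = ε`.
  set K := (√ε)⁻¹ with hK
  have hK0 : 0 < K := inv_pos.2 (Real.sqrt_pos.2 hε)
  have hKε : 1 / K ^ 2 = ε := by rw [hK, inv_pow, one_div, inv_inv, Real.sq_sqrt hε.le]
  obtain ⟨C, hC, b, hb, hmain⟩ := exists_tvDist_posterior_le (f := f) (g := g) (ρ := ρ) (K := K)
    hc₀ hf hg hqmin (by linarith : qmin ≤ qmax) hρ hC₁.le hK0.le
  refine ⟨C, hC, ?_⟩
  filter_upwards [eventually_gt_atTop 0, hrate.eventually (ge_mem_nhds (inv_pos.2 hb))]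
    with n hn hbn
  have hmn : 1 ≤ m n := by linarith [hm n]
  have hne : Nonempty (Grid (m n)) := ⟨(⟨0, hmn⟩, ⟨0, hmn⟩)⟩
  have hle := pow_five_div_sqrt_le_bvmRate (hm n) n
  have hcard : √(Fintype.card (Grid (m n)) : ℝ) = m n := by
    rw [Fintype.card_prod, Fintype.card_fin, Nat.cast_mul, Real.sqrt_mul_self (Nat.cast_nonneg _)]
  have htail := stdGaussian_norm_tail (ι := Grid (m n)) hK0
  rw [hcard, hKε, ← (hη n).map_eq] at htail
  -- The bad event lies in the event of large noise; an outer-measure bound is enough, so its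
  -- measurability is not needed.
  refine le_trans (measure_mono fun ω hω => ?_)
    ((Measure.le_map_apply (hη n).aemeasurable _).trans htail)
  by_contra hcon
  have hnorm : ‖η n ω‖ ≤ K * m n := not_lt.1 hcon
  have h := hmain (m n) n (q₀ n) (η n ω) (p n) hmn hn (hq₀ n) (hp.density n)
    (fun i x hx y hy => hlip n i x hx y hy (by
      rw [abs_le]; constructor <;> linarith [hx.1, hx.2, hy.1, hy.2])) hnorm (by
      rw [← le_div_iff₀' hb, one_div]; exact hle.trans hbn)
  have hω' : C * bvmRate n (m n) < _ := hω
  rw [abs_of_nonneg (tvDist_nonneg _ _)] at hω'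
  exact absurd (hω'.trans_le (h.trans (mul_le_mul_of_nonneg_left hle hC.le))) (lt_irrefl _)
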